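/- Let $\mathcal G$ be a finite game with players $p=1,\dots,N$, finite non-empty action sets $\mathcal A^p$ with $|\mathcal A^p|=n^p$, $n=\sum_p n^p$, and mixed strategy space $\Delta=\prod_p\Delta^p$. Let $U^p(x)$ be the expected payoff of player $p$ at $x\in\Delta$, let $U_i^p(x)$ be the expected payoff of player $p$ when he plays action $i$ and the others play according to $x$, and let $U=(U_i^p)_{p,i}:\Delta\to\mathbb R^n$. For $\epsilon>0$ let $\sigma=(\sigma^p)_p:\mathbb R^n\to\Delta$ be the soft-max map $\sigma_i^p(z)=e^{z_i^p/\epsilon}/\sum_j e^{z_j^p/\epsilon}$. A Nash distribution is a Nash equilibrium of the game with the perturbed payoffs $U^p(x)-\epsilon\sum_i x_i^p\log x_i^p$. Let $\gamma>0$. The EXP-D-RL dynamics are $\dot z=\gamma(U(\sigma(z))-z)$; their rest points are the fixed points of $U\circ\sigma$. The H-EXP-D-RL dynamics are, with $x=\sigma(z)$, $$\dot z=\gamma(-z+U(x)-v_a),\qquad \dot\xi=\mathbf A\xi+\mathbf Bx,\qquad v_a=\mathbf C\xi+\mathbf Dx,$$ where the real matrices $\mathbf A,\mathbf B,\mathbf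 C,\mathbf D$ are block-diagonal with one block per player. Let $\mathbf H_a(s)=\mathbf C(s\mathbf I-\mathbf A)^{-1}\mathbf B+\mathbf D$. Theorem 2. Assume that $U\circ\sigma$ has finitely many fixed points. Assume that the realization $(\mathbf A,\mathbf B,\mathbf C,\mathbf D)$ has no uncontrollable or unobservable mode in the closed right half-plane (which holds if it is controllable and observable), that $\mathbf H_a$ (proper, by its form) is positive real with all its poles in the open left half-plane, that is, no entry of $\mathbf H_a$ has a pole in $\operatorname{Re}s\ge 0$ and $\mathbf H_a(i\omega)+\mathbf H_a(i\omega)^{*}\succeq 0$ for all real $\omega$ (which holds if $\mathbf H_a$ is strictly positive real), and that $\mathbf H_a(0)=0$. Then: 1. A point $\bar z\in\mathbb R^n$ is the score component of a rest point $(\bar z,\bar\xi)$ of H-EXP-D-RL if and only if it is a rest point of EXP-D-RL. 2. If $-(x-x')^\top(U(x)-U(x'))\ge 0$ for all $x,x'\in\Delta$, then for every solution $(z(t),\xi(t))_{t\ge 0}$ of H-EXP-D-RL, with any initial state, the scores $z(t)$ converge as $t\to\infty$ to some $\bar z^*$ with $\bar z^*=U(\sigma(\bar z^*))$, and the strategies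 $x(t)=\sigma(z(t))$ converge to $\bar x^*=\sigma(\bar z^*)$, which is a Nash distribution. 3. If $\mu>0$ and $-(x-x')^\top(U(x)-U(x'))\ge-\mu\|x-x'\|_2^2$ for all $x,x'\in\Delta$, then the conclusion of 2 holds whenever $\epsilon>\mu$. -/

import Mathlib

open Set Filter Topology

noncomputable section

namespace HExpDRL

/-! ### Finite games and their mixed extension

`P` is the set of players and `𝒜 p` is the action set of player `p`. A vector of `ℝⁿ`, with
`n = ∑ p, |𝒜 p|`, is a family `∀ p, 𝒜 p → ℝ`. A game is given by its payoffs
`u p a` at the pure profiles `a : ∀ q, 𝒜 q`. -/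

section Game

variable {P : Type*} [Fintype P] [DecidableEq P] {𝒜 : P → Type*}
  [∀ p, Fintype (𝒜 p)] [∀ p, DecidableEq (𝒜 p)]

/-- The set `Δ = ∏ₚ Δᵖ` of mixed strategy profiles. -/
def strategySpace (𝒜 : P → Type*) [∀ p, Fintype (𝒜 p)] : Set (∀ p, 𝒜 p → ℝ) :=
  {x | ∀ p, x p ∈ stdSimplex ℝ (𝒜 p)}

/-- The expected payoff `Uᵖ(x)` of player `p` at the mixed profile `x`. -/
def expectedPayoff (u : P → (∀ q, 𝒜 q) → ℝ) (p : P) (x : ∀ q, 𝒜 q → ℝ) : ℝ :=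
  ∑ a : ∀ q, 𝒜 q, u p a * ∏ q, x q (a q)

/-- The game map `U`: the entry `U x p i` is the expected payoff of player `p` when `p` plays the
pure strategy `i` and the others play according to `x`. -/
def payoffMap (u : P → (∀ q, 𝒜 q) → ℝ) (x : ∀ q, 𝒜 q → ℝ) : ∀ p, 𝒜 p → ℝ :=
  fun p i => expectedPayoff u p (Function.update x p (Pi.single i 1))

/-- `x` is a Nash equilibrium of the game with payoff functions `V p` on mixed profiles. -/
def IsNashEquilibrium (V : P → (∀ q, 𝒜 q → ℝ) → ℝ) (x : ∀ q, 𝒜 q → ℝ) : Prop :=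
  x ∈ strategySpace 𝒜 ∧
    ∀ p, ∀ y ∈ stdSimplex ℝ (𝒜 p), V p (Function.update x p y) ≤ V p x

/-- The entropy-perturbed payoff `Uᵖ(x) - ε ∑ᵢ xᵢᵖ log xᵢᵖ`. -/
def perturbedPayoff (u : P → (∀ q, 𝒜 q) → ℝ) (ε : ℝ) (p : P) (x : ∀ q, 𝒜 q → ℝ) : ℝ :=
  expectedPayoff u p x - ε * ∑ i, x p i * Real.log (x p i)

/-- A Nash distribution (logit equilibrium) at temperature `ε`: a Nash equilibrium of the game
with entropy-perturbed payoffs. -/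
def IsNashDistribution (u : P → (∀ q, 𝒜 q) → ℝ) (ε : ℝ) (x : ∀ q, 𝒜 q → ℝ) : Prop :=
  IsNashEquilibrium (perturbedPayoff u ε) x

/-- `-U` is monotone on `Δ`. -/
def NegPayoffMonotone (u : P → (∀ q, 𝒜 q) → ℝ) : Prop :=
  ∀ x ∈ strategySpace 𝒜, ∀ x' ∈ strategySpace 𝒜,
    0 ≤ -∑ p, (x p - x' p) ⬝ᵥ (payoffMap u x p - payoffMap u x' p)

/-- `-U` is `μ`-hypo-monotone on `Δ`. -/
def NegPayoffHypoMonotone (u : P → (∀ q, 𝒜 q) → ℝ) (μ : ℝ) : Prop :=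
  ∀ x ∈ strategySpace 𝒜, ∀ x' ∈ strategySpace 𝒜,
    -μ * ∑ p, (x p - x' p) ⬝ᵥ (x p - x' p) ≤
      -∑ p, (x p - x' p) ⬝ᵥ (payoffMap u x p - payoffMap u x' p)

/-- The soft-max choice map `σ` at temperature `ε`, applied to the scores of each player. -/
def softmax (ε : ℝ) (z : ∀ p, 𝒜 p → ℝ) : ∀ p, 𝒜 p → ℝ :=
  fun p i => Real.exp (z p i / ε) / ∑ j, Real.exp (z p j / ε)

end Game

/-! ### Linear time-invariant systems `ξ' = Aξ + Bx`, `v = Cξ + Dx` -/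

section LTI

variable {S ι κ : Type*} [Fintype S] [DecidableEq S] [Fintype ι] [Fintype κ]

/-- A real matrix, read as a complex one. -/
def toComplex {ι κ : Type*} (M : Matrix ι κ ℝ) : Matrix ι κ ℂ :=
  M.map (fun r => (r : ℂ))

/-- The transfer matrix `H(s) = C (sI - A)⁻¹ B + D` of a state-space realization; being of this
form, it is rational and proper. -/
def transferMatrix (A : Matrix S S ℝ) (B : Matrix S κ ℝ) (C : Matrix ι S ℝ) (D : Matrix ι κ ℝ)
    (s : ℂ) : Matrix ι κ ℂ :=
  toComplex C * (s • (1 : Matrix S S ℂ) - toComplex A)⁻¹ * toComplex B + toComplex D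

/-- Stabilizability of `(A, B)`, by the Hautus test: no mode of `A` in the closed right half-plane
is uncontrollable. Controllable pairs have this property. -/
def IsStabilizable (A : Matrix S S ℝ) (B : Matrix S κ ℝ) : Prop :=
  ∀ l : ℂ, 0 ≤ l.re → ∀ w : S → ℂ,
    Matrix.vecMul w (toComplex A) = l • w → Matrix.vecMul w (toComplex B) = 0 → w = 0

/-- Detectability of `(A, C)`, by the Hautus test: no mode of `A` in the closed right half-plane
is unobservable. Observable pairs have this property. -/
def IsDetectable (A : Matrix S S ℝ) (C : Matrix ι S ℝ) : Prop :=
  ∀ l : ℂ, 0 ≤ l.re → ∀ w : S → ℂ,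
    Matrix.mulVec (toComplex A) w = l • w → Matrix.mulVec (toComplex C) w = 0 → w = 0

open scoped ComplexOrder Matrix in
/-- A square rational transfer matrix is positive real with all its poles in the open left
half-plane: no entry has a pole in `Re s ≥ 0`, and `H(iω) + H(iω)ᴴ` is positive semidefinite for
every real `ω`. This is implied by strict positive realness (`H(s - δ)` is positive real for some
`δ > 0`), and unlike the latter it is compatible with `H(0) = 0` for a nonzero `H`, for example
`H(s) = K s / (s + a)` with `K, a > 0`. -/
def IsStablePositiveReal (H : ℂ → Matrix ι ι ℂ) : Prop :=
  (∀ s : ℂ, 0 ≤ s.re → ∀ i j, 0 ≤ meromorphicOrderAt (fun s' => H s' i j) s) ∧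
    ∀ ω : ℝ, (H ((ω : ℂ) * Complex.I) + (H ((ω : ℂ) * Complex.I))ᴴ).PosSemidef

end LTI

/-! ### The learning dynamics -/

section Dynamics

variable {P : Type*} [Fintype P] [DecidableEq P] {𝒜 : P → Type*}
  [∀ p, Fintype (𝒜 p)] [∀ p, DecidableEq (𝒜 p)]
  {S : P → Type*} [∀ p, Fintype (S p)] [∀ p, DecidableEq (S p)]

/-- The right-hand side of EXP-D-RL: `z' = γ (U(σ(z)) - z)`. -/
def expField (u : P → (∀ q, 𝒜 q) → ℝ) (γ ε : ℝ) (z : ∀ p, 𝒜 p → ℝ) : ∀ p, 𝒜 p → ℝ :=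
  γ • (payoffMap u (softmax ε z) - z)

/-- The adjustment `vₐᵖ = Cᵖ ξᵖ + Dᵖ xᵖ` of each player, where `x = σ(z)`. -/
def adjustment (ε : ℝ) (C : ∀ p, Matrix (𝒜 p) (S p) ℝ) (D : ∀ p, Matrix (𝒜 p) (𝒜 p) ℝ)
    (z : ∀ p, 𝒜 p → ℝ) (ξ : ∀ p, S p → ℝ) : ∀ p, 𝒜 p → ℝ :=
  fun p => Matrix.mulVec (C p) (ξ p) + Matrix.mulVec (D p) (softmax ε z p)

/-- The score component of the right-hand side of H-EXP-D-RL: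
`z' = γ (-z + U(σ(z)) - vₐ)`. -/
def hScoreField (u : P → (∀ q, 𝒜 q) → ℝ) (γ ε : ℝ)
    (C : ∀ p, Matrix (𝒜 p) (S p) ℝ) (D : ∀ p, Matrix (𝒜 p) (𝒜 p) ℝ)
    (z : ∀ p, 𝒜 p → ℝ) (ξ : ∀ p, S p → ℝ) : ∀ p, 𝒜 p → ℝ :=
  γ • (-z + payoffMap u (softmax ε z) - adjustment ε C D z ξ)

/-- The auxiliary component of the right-hand side of H-EXP-D-RL:
`(ξᵖ)' = Aᵖ ξᵖ + Bᵖ xᵖ`, where `x = σ(z)`. -/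
def hAuxField (ε : ℝ) (A : ∀ p, Matrix (S p) (S p) ℝ) (B : ∀ p, Matrix (S p) (𝒜 p) ℝ)
    (z : ∀ p, 𝒜 p → ℝ) (ξ : ∀ p, S p → ℝ) : ∀ p, S p → ℝ :=
  fun p => Matrix.mulVec (A p) (ξ p) + Matrix.mulVec (B p) (softmax ε z p)

/-- `(z, ξ)` is a rest point of H-EXP-D-RL. -/
def IsHRestPoint (u : P → (∀ q, 𝒜 q) → ℝ) (γ ε : ℝ)
    (A : ∀ p, Matrix (S p) (S p) ℝ) (B : ∀ p, Matrix (S p) (𝒜 p) ℝ)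
    (C : ∀ p, Matrix (𝒜 p) (S p) ℝ) (D : ∀ p, Matrix (𝒜 p) (𝒜 p) ℝ)
    (z : ∀ p, 𝒜 p → ℝ) (ξ : ∀ p, S p → ℝ) : Prop :=
  hScoreField u γ ε C D z ξ = 0 ∧ hAuxField ε A B z ξ = 0

/-- `(z(t), ξ(t))`, `t ≥ 0`, is a solution of H-EXP-D-RL, with arbitrary initial state. -/
def IsHSolution (u : P → (∀ q, 𝒜 q) → ℝ) (γ ε : ℝ)
    (A : ∀ p, Matrix (S p) (S p) ℝ) (B : ∀ p, Matrix (S p) (𝒜 p) ℝ)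
    (C : ∀ p, Matrix (𝒜 p) (S p) ℝ) (D : ∀ p, Matrix (𝒜 p) (𝒜 p) ℝ)
    (z : ℝ → ∀ p, 𝒜 p → ℝ) (ξ : ℝ → ∀ p, S p → ℝ) : Prop :=
  ∀ t : ℝ, 0 ≤ t →
    HasDerivWithinAt z (hScoreField u γ ε C D (z t) (ξ t)) (Ici 0) t ∧
      HasDerivWithinAt ξ (hAuxField ε A B (z t) (ξ t)) (Ici 0) t

/-- Along every solution of H-EXP-D-RL the scores converge to a rest point `zbar` of EXP-D-RL (a
fixed point of `U ∘ σ`), and the strategies `x(t) = σ(z(t))` converge to `σ(zbar)`, which is a Nash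
distribution. -/
def SolutionsConverge (u : P → (∀ q, 𝒜 q) → ℝ) (γ ε : ℝ)
    (A : ∀ p, Matrix (S p) (S p) ℝ) (B : ∀ p, Matrix (S p) (𝒜 p) ℝ)
    (C : ∀ p, Matrix (𝒜 p) (S p) ℝ) (D : ∀ p, Matrix (𝒜 p) (𝒜 p) ℝ) : Prop :=
  ∀ (z : ℝ → ∀ p, 𝒜 p → ℝ) (ξ : ℝ → ∀ p, S p → ℝ), IsHSolution u γ ε A B C D z ξ →
    ∃ zbar : ∀ p, 𝒜 p → ℝ,
      payoffMap u (softmax ε zbar) = zbar ∧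
      Tendsto z atTop (𝓝 zbar) ∧
      Tendsto (fun t => softmax ε (z t)) atTop (𝓝 (softmax ε zbar)) ∧
      IsNashDistribution u ε (softmax ε zbar)

end Dynamics

end HExpDRL

end

namespace HExpDRL

/-! ### Hautus tests and poles: the state matrix is Hurwitz -/

section Resolvent

variable {S ι κ : Type*} [Fintype S] [DecidableEq S] [Fintype ι] [Fintype κ]

/-! The adjustment block is a passive linear system with zero steady-state gain. Since its transfer
matrix vanishes at 0, its output is zero at each of its equilibria, so it cannot move the rest
points (`isHRestPoint_iff`); passivity keeps it from spoiling convergence.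

Fix zbar with U(σ(zbar)) = zbar and put xbar = σ(zbar), w = σ(z) - xbar. The energy `scoreEnergy`,
the soft maximum of z minus its pairing with xbar, is bounded below. The soft-max map is the
gradient of the soft maximum and is ε-cocoercive (`softmaxVec_cocoercive`), so under
μ-hypo-monotonicity the energy has derivative at most -γ(ε - μ)|w|² - γ w·vₐ. The integral of w·vₐ
is bounded below uniformly in the horizon (`exists_le_integral_supply`), so |w|² is integrable and,
being Lipschitz in time, tends to 0 (`tendsto_zero_of_lipschitz_of_integral_le`). The rest is a
cascade of exponentially stable linear equations with vanishing input: ξ tends to an equilibrium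
because A is Hurwitz (`re_neg_of_eigenvector`), hence vₐ → 0, hence z → zbar.

Passivity is obtained in the frequency domain, without a storage function. Adding a decaying free
motion makes the state take equal values at 0 and T, and Parseval then writes the absorbed energy as
a sum of terms Re wₙ* H(iωₙ) wₙ ≥ 0 (`integral_supply_nonneg_of_periodic`). The fixed point comes
from minimizing the duality gap of the perturbed game (`exists_fixedPoint`): a nonzero step towards
the soft-max response would decrease it at first order. -/

theorem exists_norm_le_of_detectable (M : Matrix S S ℂ) (N : Matrix κ S ℂ) (l : ℂ)
    (h : ∀ w : S → ℂ, M.mulVec w = l • w → N.mulVec w = 0 → w = 0) :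
    ∃ K : ℝ, 0 < K ∧ ∀ᶠ s in 𝓝 l, ∀ w : S → ℂ,
      ‖w‖ ≤ K * (‖(s • (1 : Matrix S S ℂ) - M).mulVec w‖ + ‖N.mulVec w‖) := by
  let f : (S → ℂ) →ₗ[ℂ] (S → ℂ) × (κ → ℂ) :=
    (Matrix.mulVecLin (l • (1 : Matrix S S ℂ) - M)).prod (Matrix.mulVecLin N)
  have hf : LinearMap.ker f = ⊥ := by
    rw [LinearMap.ker_eq_bot']
    intro w hw
    have h1 : (l • (1 : Matrix S S ℂ) - M).mulVec w = 0 := congrArg Prod.fst hw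
    have h2 : N.mulVec w = 0 := congrArg Prod.snd hw
    refine h w ?_ h2
    rw [Matrix.sub_mulVec, Matrix.smul_mulVec, Matrix.one_mulVec, sub_eq_zero] at h1
    exact h1.symm
  obtain ⟨K, hK, hanti⟩ := f.exists_antilipschitzWith hf
  have hbound : ∀ w, ‖w‖ ≤ K * (‖(l • (1 : Matrix S S ℂ) - M).mulVec w‖ + ‖N.mulVec w‖) := by
    intro w
    have := hanti.le_mul_dist w 0
    rw [map_zero, dist_zero_right, dist_zero_right] at this
    refine this.trans (mul_le_mul_of_nonneg_left ?_ K.2)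
    exact max_le_add_of_nonneg (norm_nonneg _) (norm_nonneg _)
  have hK' : (0 : ℝ) < K := hK
  -- Replacing l by s costs ‖s - l‖‖w‖. Within distance 1/(2K) of l this absorbs half of ‖w‖, hence
  -- the doubled constant.
  refine ⟨2 * K, by positivity, ?_⟩
  filter_upwards [Metric.ball_mem_nhds l (show (0 : ℝ) < 1 / (2 * K) by positivity)] with s hs w
  rw [mem_ball_iff_norm, lt_div_iff₀ (by positivity)] at hs
  have h1 : (l • (1 : Matrix S S ℂ) - M).mulVec w
      = (s • (1 : Matrix S S ℂ) - M).mulVec w - (s - l) • w := by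
    simp only [Matrix.sub_mulVec, Matrix.smul_mulVec, Matrix.one_mulVec, sub_smul]
    abel
  have h2 := hbound w
  have h3 : ‖(l • (1 : Matrix S S ℂ) - M).mulVec w‖
      ≤ ‖(s • (1 : Matrix S S ℂ) - M).mulVec w‖ + ‖s - l‖ * ‖w‖ := by
    rw [h1, ← norm_smul]
    exact norm_sub_le _ _
  nlinarith [mul_le_mul_of_nonneg_left h3 hK'.le, mul_le_mul_of_nonneg_right hs.le (norm_nonneg w)]

/-- Cramer's rule: an entry of the resolvent is a quotient of two polynomials in s. Meromorphy is
what lets a nonnegative order be read as boundedness near l. -/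
theorem meromorphicAt_inv_apply (M : Matrix S S ℂ) (i j : S) (l : ℂ) :
    MeromorphicAt (fun s : ℂ => (s • (1 : Matrix S S ℂ) - M)⁻¹ i j) l := by
  have hd : ∀ F : ℂ → Matrix S S ℂ, (∀ a b, Differentiable ℂ fun s => F s a b) →
      MeromorphicAt (fun s => (F s).det) l := by
    intro F hF
    refine (Differentiable.analyticAt (f := fun s => (F s).det) ?_ l).meromorphicAt
    simp only [Matrix.det_apply]
    fun_prop
  have hE : ∀ a b, Differentiable ℂ fun s : ℂ => (s • (1 : Matrix S S ℂ) - M) a b := by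
    intro a b
    simp only [Matrix.sub_apply, Matrix.smul_apply, smul_eq_mul]
    fun_prop
  have h1 := (hd _ hE).inv
  have h2 : MeromorphicAt (fun s : ℂ =>
      ((s • (1 : Matrix S S ℂ) - M).updateRow j (Pi.single i 1)).det) l := by
    refine hd _ fun a b => ?_
    by_cases ha : a = j
    · subst ha
      simp
    · simpa only [Matrix.updateRow_ne ha] using hE a b
  refine (h1.mul h2).congr (Eventually.of_forall fun s => ?_)
  simp [Matrix.inv_def, Matrix.adjugate_apply]

theorem eventually_isUnit_det (M : Matrix S S ℂ) (l : ℂ) :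
    ∀ᶠ s in 𝓝[≠] l, IsUnit (s • (1 : Matrix S S ℂ) - M).det := by
  have h := (M.charpoly.roots.toFinset.finite_toSet.subset
    (sdiff_subset (t := {l}))).isClosed.isOpen_compl.mem_nhds
    (show l ∈ (((M.charpoly.roots.toFinset : Set ℂ) \ {l})ᶜ) by simp)
  filter_upwards [nhdsWithin_le_nhds h, self_mem_nhdsWithin] with s hs hsl
  rw [isUnit_iff_ne_zero]
  intro h0
  refine hs ⟨?_, hsl⟩
  simp only [Finset.mem_coe, Multiset.mem_toFinset]
  rw [Polynomial.mem_roots M.charpoly_monic.ne_zero, Polynomial.IsRoot, Matrix.eval_charpoly]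
  rw [← h0]
  congr 2
  ext a b
  simp [Matrix.scalar_apply, Matrix.diagonal_apply, Matrix.one_apply]

/-- A column of R(s)Q, with R the resolvent, is sent by s - M to a column of Q and by N to a column
of N R(s) Q. Both are bounded, so the uniform lower bound near l bounds the column itself. This
strips the factor N from N R(s) Q. -/
theorem eventually_norm_mul_le_of_detectable (M : Matrix S S ℂ) (N : Matrix κ S ℂ) (l : ℂ)
    (h : ∀ w : S → ℂ, M.mulVec w = l • w → N.mulVec w = 0 → w = 0) (Q : Matrix S ι ℂ)
    (hb : ∃ c : ℝ, ∀ᶠ s in 𝓝[≠] l, ∀ i j,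
      ‖(N * (s • (1 : Matrix S S ℂ) - M)⁻¹ * Q) i j‖ ≤ c) :
    ∃ c : ℝ, ∀ᶠ s in 𝓝[≠] l, ∀ i j, ‖((s • (1 : Matrix S S ℂ) - M)⁻¹ * Q) i j‖ ≤ c := by
  obtain ⟨K, hK, hev⟩ := exists_norm_le_of_detectable M N l h
  obtain ⟨c, hc⟩ := hb
  obtain ⟨c', hc'⟩ : ∃ c' : ℝ, ∀ i j, ‖Q i j‖ ≤ c' :=
    ⟨∑ i, ∑ j, ‖Q i j‖, fun i j =>
      (Finset.single_le_sum (f := fun j => ‖Q i j‖) (fun _ _ => norm_nonneg _)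
        (Finset.mem_univ j)).trans
      (Finset.single_le_sum (f := fun i => ∑ j, ‖Q i j‖)
        (fun _ _ => Finset.sum_nonneg fun _ _ => norm_nonneg _) (Finset.mem_univ i))⟩
  refine ⟨K * (|c'| + |c|), ?_⟩
  filter_upwards [hc, nhdsWithin_le_nhds hev, eventually_isUnit_det M l] with s h1 h2 h3 i j
  set R := (s • (1 : Matrix S S ℂ) - M)⁻¹ with hR
  have h4 := h2 (fun k => (R * Q) k j)
  have e1 : (s • (1 : Matrix S S ℂ) - M).mulVec (fun k => (R * Q) k j) = fun k => Q k j := by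
    ext k
    change ((s • (1 : Matrix S S ℂ) - M) * (R * Q)) k j = Q k j
    rw [← Matrix.mul_assoc, Matrix.mul_nonsing_inv _ h3, Matrix.one_mul]
  have e2 : N.mulVec (fun k => (R * Q) k j) = fun k => (N * R * Q) k j := by
    ext k
    change (N * (R * Q)) k j = _
    rw [Matrix.mul_assoc]
  rw [e1, e2] at h4
  refine (norm_le_pi_norm (fun k => (R * Q) k j) i).trans (h4.trans ?_)
  refine mul_le_mul_of_nonneg_left (add_le_add ?_ ?_) hK.le
  · exact (pi_norm_le_iff_of_nonneg (abs_nonneg _)).2 fun k => (hc' k j).trans (le_abs_self _)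
  · exact (pi_norm_le_iff_of_nonneg (abs_nonneg _)).2 fun k => (h1 k j).trans (le_abs_self _)

theorem smul_one_sub_transpose_inv (M : Matrix S S ℂ) (s : ℂ) :
    (s • (1 : Matrix S S ℂ) - M.transpose)⁻¹ = ((s • (1 : Matrix S S ℂ) - M)⁻¹).transpose := by
  rw [Matrix.transpose_nonsing_inv]
  simp

/-- A stabilizable and detectable realization of a transfer matrix without poles in the closed
right half-plane has a Hurwitz state matrix. -/
theorem re_neg_of_eigenvector {A : Matrix S S ℝ} {B : Matrix S ι ℝ} {C : Matrix ι S ℝ}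
    {D : Matrix ι ι ℝ} (hstab : IsStabilizable A B) (hdet : IsDetectable A C)
    (hH : IsStablePositiveReal (transferMatrix A B C D)) {l : ℂ} {w : S → ℂ} (hw : w ≠ 0)
    (hl : (toComplex A).mulVec w = l • w) : l.re < 0 := by
  by_contra! hre
  set M := toComplex A with hM
  have hb : ∃ c : ℝ, ∀ᶠ s in 𝓝[≠] l, ∀ i j,
      ‖(toComplex C * (s • (1 : Matrix S S ℂ) - M)⁻¹ * toComplex B) i j‖ ≤ c := by
    have h1 : ∀ i j, ∃ c : ℝ, ∀ᶠ s in 𝓝[≠] l, ‖transferMatrix A B C D s i j‖ ≤ c := by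
      intro i j
      have hm : MeromorphicAt (fun s => transferMatrix A B C D s i j) l := by
        simp only [transferMatrix, Matrix.add_apply, Matrix.mul_apply]
        refine MeromorphicAt.fun_add (MeromorphicAt.fun_sum fun k _ => ?_)
          (MeromorphicAt.const _ _)
        refine MeromorphicAt.fun_mul (MeromorphicAt.fun_sum fun k' _ => ?_)
          (MeromorphicAt.const _ _)
        exact MeromorphicAt.fun_mul (MeromorphicAt.const _ _) (meromorphicAt_inv_apply _ _ _ _)
      obtain ⟨c, hc⟩ := tendsto_nhds_of_meromorphicOrderAt_nonneg hm (hH.1 l hre i j)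
      exact ⟨‖c‖ + 1, (hc.norm.eventually_lt_const (lt_add_one _)).mono fun _ h => h.le⟩
    choose c hc using h1
    have hc' : ∀ᶠ s in 𝓝[≠] l, ∀ i j, ‖transferMatrix A B C D s i j‖ ≤ c i j := by
      simpa only [eventually_all] using hc
    refine ⟨∑ i, ∑ j, (|c i j| + ‖toComplex D i j‖), hc'.mono fun s hs i j => ?_⟩
    have e : (toComplex C * (s • (1 : Matrix S S ℂ) - M)⁻¹ * toComplex B) i j
        = transferMatrix A B C D s i j - toComplex D i j := by
      simp [transferMatrix, hM]
    rw [e]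
    refine (norm_sub_le _ _).trans
      ((add_le_add_left ((hs i j).trans (le_abs_self _)) _).trans ?_)
    have hn : ∀ i j, 0 ≤ |c i j| + ‖toComplex D i j‖ := fun _ _ => by positivity
    exact (Finset.single_le_sum (f := fun j => |c i j| + ‖toComplex D i j‖) (fun j _ => hn i j)
        (Finset.mem_univ j)).trans
      (Finset.single_le_sum (f := fun i => ∑ j, (|c i j| + ‖toComplex D i j‖))
        (fun i _ => Finset.sum_nonneg fun j _ => hn i j) (Finset.mem_univ i))
  -- Detectability strips C from C R(s) B. Stabilizability, read as detectability of the transposed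
  -- pair, strips B in turn, so the resolvent stays bounded near l.
  have hRB := eventually_norm_mul_le_of_detectable M (toComplex C) l (hdet l hre) _ hb
  have hR := eventually_norm_mul_le_of_detectable M.transpose (toComplex B).transpose l
    (fun w h1 h2 => hstab l hre w (by rwa [Matrix.mulVec_transpose] at h1)
      (by rwa [Matrix.mulVec_transpose] at h2)) (1 : Matrix S S ℂ) (by
      obtain ⟨c, hc⟩ := hRB
      refine ⟨c, hc.mono fun s hs i j => ?_⟩
      rw [smul_one_sub_transpose_inv, Matrix.mul_one, ← Matrix.transpose_mul,
        Matrix.transpose_apply]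
      exact hs j i)
  obtain ⟨c, hc⟩ := hR
  -- On the eigenvector w = (s - l) R(s) w. With R bounded, the right-hand side tends to 0 as s → l,
  -- which forces w = 0.
  have hlim : Tendsto (fun s : ℂ => ‖s - l‖ * (Fintype.card S * (c * ‖w‖))) (𝓝[≠] l) (𝓝 0) := by
    have : Tendsto (fun s : ℂ => ‖s - l‖ * (Fintype.card S * (c * ‖w‖))) (𝓝 l)
        (𝓝 (‖l - l‖ * (Fintype.card S * (c * ‖w‖)))) := Continuous.tendsto (by fun_prop) l
    simp only [sub_self, norm_zero, zero_mul] at this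
    exact this.mono_left nhdsWithin_le_nhds
  have hle : ∀ᶠ s in 𝓝[≠] l, ‖w‖ ≤ ‖s - l‖ * (Fintype.card S * (c * ‖w‖)) := by
    filter_upwards [hc, eventually_isUnit_det M l] with s hs hu
    have hcn : S → 0 ≤ c := fun i => (norm_nonneg _).trans (hs i i)
    have e1 : (s • (1 : Matrix S S ℂ) - M).mulVec w = (s - l) • w := by
      simp only [Matrix.sub_mulVec, Matrix.smul_mulVec, Matrix.one_mulVec, sub_smul, hl]
    have e2 : w = (s - l) • ((s • (1 : Matrix S S ℂ) - M)⁻¹).mulVec w := by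
      rw [← Matrix.mulVec_smul, ← e1, Matrix.mulVec_mulVec, Matrix.nonsing_inv_mul _ hu,
        Matrix.one_mulVec]
    have h3 : ‖((s • (1 : Matrix S S ℂ) - M)⁻¹).mulVec w‖ ≤ Fintype.card S * (c * ‖w‖) := by
      rcases isEmpty_or_nonempty S with hS | ⟨⟨i0⟩⟩
      · exact absurd (Subsingleton.elim w 0) hw
      have hc0 := hcn i0
      refine (pi_norm_le_iff_of_nonneg (by positivity)).2 fun i => ?_
      rw [Matrix.mulVec, dotProduct]
      refine (norm_sum_le _ _).trans ?_
      have : ∀ j ∈ Finset.univ, ‖(s • (1 : Matrix S S ℂ) - M)⁻¹ i j * w j‖ ≤ c * ‖w‖ := by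
        intro j _
        rw [norm_mul]
        have h5 := hs j i
        rw [smul_one_sub_transpose_inv, Matrix.mul_one, Matrix.transpose_apply] at h5
        exact mul_le_mul h5 (norm_le_pi_norm w j) (norm_nonneg _) hc0
      refine (Finset.sum_le_sum this).trans ?_
      simp
    calc ‖w‖ = ‖s - l‖ * ‖((s • (1 : Matrix S S ℂ) - M)⁻¹).mulVec w‖ := by
          rw [← norm_smul, ← e2]
      _ ≤ _ := mul_le_mul_of_nonneg_left h3 (norm_nonneg _)
  have : ‖w‖ ≤ 0 := ge_of_tendsto hlim hle
  exact hw (norm_le_zero_iff.1 this)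

end Resolvent

/-! ### Exponential decay of the semigroup of a Hurwitz operator -/

section ExponentialDecay

variable {E : Type*} [NormedAddCommGroup E] [NormedSpace ℂ E]

theorem exists_eigenvector_of_mem_spectrum [FiniteDimensional ℂ E] (T : E →L[ℂ] E) {μ : ℂ}
    (hμ : μ ∈ spectrum ℂ T) :
    ∃ w : E, w ≠ 0 ∧ T w = μ • w := by
  have : CompleteSpace E := FiniteDimensional.complete ℂ E
  by_contra! h
  refine hμ ?_
  change IsUnit (algebraMap ℂ (E →L[ℂ] E) μ - T)
  rw [ContinuousLinearMap.isUnit_iff_bijective]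
  have hinj : Function.Injective
      ((algebraMap ℂ (E →L[ℂ] E) μ - T : E →L[ℂ] E) : E →ₗ[ℂ] E) := by
    rw [← LinearMap.ker_eq_bot, LinearMap.ker_eq_bot']
    intro w hw
    by_contra hw0
    refine h w hw0 ?_
    have : μ • w - T w = 0 := by simpa [Algebra.algebraMap_eq_smul_one] using hw
    exact (sub_eq_zero.1 this).symm
  exact ⟨hinj, LinearMap.injective_iff_surjective.1 hinj⟩

theorem exp_apply_of_eigenvector [CompleteSpace E] (T : E →L[ℂ] E) {l : ℂ} {v : E}
    (hv : T v = l • v) : NormedSpace.exp T v = Complex.exp l • v := by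
  have h0 := NormedSpace.exp_series_hasSum_exp' (𝕂 := ℂ) T
  have h1 : HasSum (fun n : ℕ => ((n.factorial : ℂ)⁻¹ • T ^ n) v) (NormedSpace.exp T v) := by
    simpa only [ContinuousLinearMap.apply_apply] using
      h0.mapL (ContinuousLinearMap.apply ℂ E v)
  have hpow : ∀ n : ℕ, (T ^ n) v = l ^ n • v := by
    intro n
    induction n with
    | zero => simp
    | succ n ih =>
      rw [pow_succ', mul_apply_eq_comp, ih, map_smul, hv, smul_smul, pow_succ]
  have h2 : HasSum (fun n : ℕ => ((n.factorial : ℂ)⁻¹ • l ^ n) • v) (Complex.exp l • v) := by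
    rw [Complex.exp_eq_exp_ℂ]
    exact (NormedSpace.exp_series_hasSum_exp' (𝕂 := ℂ) l).smul_const v
  refine h1.unique (h2.congr_fun ?_)
  intro n
  simp [hpow, smul_smul]

/-- T commutes with exp T, so it preserves the μ-eigenspace `W` of exp T and has an eigenvector
there; on it exp T acts as exp l. This is the half of the spectral mapping theorem that transfers
decay from T to exp T. -/
theorem exists_eigenvector_of_exp [FiniteDimensional ℂ E] [CompleteSpace E]
    (T : E →L[ℂ] E) {μ : ℂ} {w : E} (hw : w ≠ 0)
    (hμ : NormedSpace.exp T w = μ • w) :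
    ∃ (l : ℂ) (v : E), v ≠ 0 ∧ T v = l • v ∧ Complex.exp l = μ := by
  let W : Submodule ℂ E := LinearMap.ker
    ((NormedSpace.exp T - μ • (1 : E →L[ℂ] E) : E →L[ℂ] E) : E →ₗ[ℂ] E)
  have hmem : ∀ x, x ∈ W ↔ NormedSpace.exp T x = μ • x := by
    intro x
    simp [W, sub_eq_zero]
  have hinv : ∀ x ∈ W, (T : E →ₗ[ℂ] E) x ∈ W := by
    intro x hx
    rw [hmem] at hx ⊢
    have hc : Commute (NormedSpace.exp T) T := ((Commute.refl T).exp_left)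
    have := congrArg (fun F : E →L[ℂ] E => F x) hc.eq
    simp only [mul_apply_eq_comp] at this
    simp only [ContinuousLinearMap.coe_coe]
    rw [this, hx, map_smul]
  have : Nontrivial W := ⟨⟨⟨w, (hmem w).2 hμ⟩, 0, fun h => hw (congrArg Subtype.val h)⟩⟩
  obtain ⟨l, hl⟩ := Module.End.exists_eigenvalue ((T : E →ₗ[ℂ] E).restrict hinv)
  obtain ⟨v, hv⟩ := hl.exists_hasEigenvector
  have h1 : T v = l • (v : E) := congrArg Subtype.val hv.apply_eq_smul
  have h2 : (v : E) ≠ 0 := fun h => hv.2 (Subtype.ext h)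
  refine ⟨l, v, h2, h1, ?_⟩
  have h3 := exp_apply_of_eigenvector T h1
  rw [(hmem v).1 v.2] at h3
  exact (smul_left_injective ℂ h2 h3).symm

/-- In finite dimension the spectrum consists of eigenvalues and is compact, so the spectral radius
is below 1. Gelfand's formula then gives ‖Tⁿ‖ ≤ 1 for all but finitely many n. -/
theorem exists_forall_norm_pow_le [FiniteDimensional ℂ E] [CompleteSpace E]
    (T : E →L[ℂ] E)
    (h : ∀ (μ : ℂ) (w : E), w ≠ 0 → T w = μ • w → ‖μ‖ < 1) :
    ∃ K : ℝ, ∀ n : ℕ, ‖T ^ n‖ ≤ K := by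
  have hr : spectralRadius ℂ T < 1 := by
    rcases (spectrum ℂ T).eq_empty_or_nonempty with he | hne
    · simp [spectralRadius, he]
    · refine spectrum.spectralRadius_lt_of_forall_lt_of_nonempty (r := 1) hne fun μ hμ => ?_
      obtain ⟨w, hw, hTw⟩ := exists_eigenvector_of_mem_spectrum T hμ
      exact_mod_cast h μ w hw hTw
  have hev := (spectrum.pow_norm_pow_one_div_tendsto_nhds_spectralRadius T).eventually_lt_const hr
  obtain ⟨N, hN⟩ := eventually_atTop.1 (hev.and (eventually_ge_atTop 1))
  refine ⟨1 + ∑ k ∈ Finset.range N, ‖T ^ k‖, fun n => ?_⟩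
  rcases lt_or_ge n N with hn | hn
  · have := Finset.single_le_sum (f := fun k => ‖T ^ k‖) (fun _ _ => norm_nonneg _)
      (Finset.mem_range.2 hn)
    linarith
  · obtain ⟨h1, h2⟩ := hN n hn
    have h3 : ‖T ^ n‖ ≤ 1 := by
      by_contra! hgt
      have : (1 : ℝ) ≤ ‖T ^ n‖ ^ (1 / n : ℝ) := Real.one_le_rpow hgt.le (by positivity)
      exact absurd h1 (not_lt.2 (by simpa using ENNReal.ofReal_le_ofReal this))
    have : 0 ≤ ∑ k ∈ Finset.range N, ‖T ^ k‖ := Finset.sum_nonneg fun _ _ => norm_nonneg _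
    linarith

/-- Split t into integer and fractional parts: the powers of exp T are bounded, and the fractional
part ranges over a compact interval. -/
theorem exists_forall_norm_exp_le [FiniteDimensional ℂ E] [CompleteSpace E]
    (T : E →L[ℂ] E)
    (h : ∀ (μ : ℂ) (w : E), w ≠ 0 → T w = μ • w → μ.re < 0) :
    ∃ K : ℝ, ∀ t : ℝ, 0 ≤ t → ‖NormedSpace.exp (t • T)‖ ≤ K := by
  let _ : NormedAlgebra ℚ (E →L[ℂ] E) := NormedAlgebra.restrictScalars ℚ ℂ _
  obtain ⟨K, hK⟩ := exists_forall_norm_pow_le (NormedSpace.exp T) (by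
    intro μ w hw hμ
    obtain ⟨l, v, hv, hTv, rfl⟩ := exists_eigenvector_of_exp T hw hμ
    rw [Complex.norm_exp]
    exact Real.exp_lt_one_iff.2 (h l v hv hTv))
  have hcont : Continuous fun t : ℝ => NormedSpace.exp (t • T) :=
    NormedSpace.exp_continuous.comp (by fun_prop)
  obtain ⟨K', hK'⟩ := (isCompact_Icc (a := (0 : ℝ)) (b := 1)).exists_bound_of_continuousOn
    hcont.continuousOn
  have hK0 : 0 ≤ K := (norm_nonneg _).trans (hK 0)
  refine ⟨K * K', fun t ht => ?_⟩
  have e : NormedSpace.exp (t • T)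
      = NormedSpace.exp T ^ ⌊t⌋₊ * NormedSpace.exp ((t - ⌊t⌋₊) • T) := by
    rw [← NormedSpace.exp_nsmul, ← NormedSpace.exp_add_of_commute]
    · congr 1
      rw [← Nat.cast_smul_eq_nsmul ℝ, ← add_smul]
      congr 1
      ring
    · exact ((Commute.refl T).smul_right _).smul_left _
  rw [e]
  refine (norm_mul_le _ _).trans (mul_le_mul (hK _) (hK' _ ⟨?_, ?_⟩) (norm_nonneg _) hK0)
  · linarith [Nat.floor_le ht]
  · linarith [Nat.lt_floor_add_one t]

/-- The semigroup generated by a Hurwitz operator decays exponentially. -/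
theorem exists_forall_norm_exp_le_exp [FiniteDimensional ℂ E] [CompleteSpace E]
    (T : E →L[ℂ] E)
    (h : ∀ (μ : ℂ) (w : E), w ≠ 0 → T w = μ • w → μ.re < 0) :
    ∃ K a : ℝ, 0 < K ∧ 0 < a ∧
      ∀ t : ℝ, 0 ≤ t → ‖NormedSpace.exp (t • T)‖ ≤ K * Real.exp (-a * t) := by
  let _ : NormedAlgebra ℚ (E →L[ℂ] E) := NormedAlgebra.restrictScalars ℚ ℂ _
  -- The spectrum is compact, so its largest real part is attained and negative. Half of that gap
  -- serves as decay rate, which leaves T + a Hurwitz with a bounded semigroup.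
  obtain ⟨a, ha, hgap⟩ : ∃ a : ℝ, 0 < a ∧ ∀ μ ∈ spectrum ℂ T, μ.re < -a := by
    rcases (spectrum ℂ T).eq_empty_or_nonempty with he | hne
    · exact ⟨1, one_pos, by simp [he]⟩
    · obtain ⟨μ, hμ, hmax⟩ := (spectrum.isCompact (𝕜 := ℂ) T).exists_isMaxOn hne
        Complex.continuous_re.continuousOn
      obtain ⟨w, hw, hTw⟩ := exists_eigenvector_of_mem_spectrum T hμ
      have := h μ w hw hTw
      refine ⟨-μ.re / 2, by linarith, fun ν hν => ?_⟩
      have h2 : ν.re ≤ μ.re := hmax hν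
      linarith
  obtain ⟨K, hK⟩ := exists_forall_norm_exp_le (T + (a : ℂ) • (1 : E →L[ℂ] E)) (by
    intro μ w hw hμ
    have hTw : T w = (μ - a) • w := by
      rw [sub_smul, ← hμ]
      simp
    have hmem : μ - a ∈ spectrum ℂ T := by
      intro hu
      have hinj := ((ContinuousLinearMap.isUnit_iff_bijective).1 hu).1
      refine hw (hinj ?_)
      simp [Algebra.algebraMap_eq_smul_one, hTw]
    have := hgap _ hmem
    simp only [Complex.sub_re, Complex.ofReal_re] at this
    linarith)
  have hK0 : 0 ≤ K := (norm_nonneg _).trans (hK 0 le_rfl)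
  refine ⟨K + 1, a, by linarith, ha, fun t ht => ?_⟩
  have e : NormedSpace.exp (t • T)
      = Real.exp (-a * t) • NormedSpace.exp (t • (T + (a : ℂ) • (1 : E →L[ℂ] E))) := by
    have hsplit : t • T = (-(t * a) : ℂ) • (1 : E →L[ℂ] E)
        + t • (T + (a : ℂ) • (1 : E →L[ℂ] E)) := by
      ext x
      simp [← Complex.coe_smul, smul_smul]
    conv_lhs => rw [hsplit]
    rw [NormedSpace.exp_add_of_commute ((Commute.one_left _).smul_left _),
      ← Algebra.algebraMap_eq_smul_one, ← NormedSpace.algebraMap_exp_comm,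
      ← Complex.exp_eq_exp_ℂ, ← Algebra.smul_def, ← Complex.coe_smul]
    congr 1
    change _ = ((Real.exp (-a * t) : ℝ) : ℂ)
    rw [Complex.ofReal_exp]
    congr 1
    push_cast
    ring
  rw [e, norm_smul, Real.norm_of_nonneg (Real.exp_pos _).le, mul_comm]
  exact mul_le_mul_of_nonneg_right ((hK t ht).trans (by linarith)) (Real.exp_pos _).le

end ExponentialDecay

/-! ### Forced linear equations: boundedness and decay -/

section LinearODE

variable {E : Type*} [NormedAddCommGroup E] [NormedSpace ℝ E]

/-- Input-to-state bound for `e' = L e + f`, where `Φ` is the exponentially decaying semigroup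
generated by `L`. -/
theorem norm_le_of_forced_linear {L : E →L[ℝ] E} {Φ : ℝ → E →L[ℝ] E} {K a : ℝ} (ha : 0 < a)
    (hK : 0 ≤ K) (hΦ0 : Φ 0 = 1) (hΦ : ∀ t, HasDerivAt Φ (Φ t * L) t)
    (hΦn : ∀ t, 0 ≤ t → ‖Φ t‖ ≤ K * Real.exp (-a * t)) {e f : ℝ → E} {t₁ t M : ℝ} (ht : t₁ ≤ t)
    (he : ∀ s ∈ Icc t₁ t, HasDerivWithinAt e (L (e s) + f s) (Icc t₁ t) s)
    (hM : ∀ s ∈ Icc t₁ t, ‖f s‖ ≤ M) :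
    ‖e t‖ ≤ K * Real.exp (-a * (t - t₁)) * ‖e t₁‖ + K * M / a := by
  have hM0 : 0 ≤ M := (norm_nonneg _).trans (hM t₁ ⟨le_rfl, ht⟩)
  -- Variation of constants: g runs from Φ(t - t₁) e(t₁) to e(t), and in its derivative the terms
  -- containing L cancel.
  set g : ℝ → E := fun s => Φ (t - s) (e s) with hg
  have hgd : ∀ s ∈ Icc t₁ t, HasDerivWithinAt g (Φ (t - s) (f s)) (Icc t₁ t) s := by
    intro s hs
    have h1 : HasDerivAt (fun s => Φ (t - s)) (-(Φ (t - s) * L)) s := by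
      have h0 := (hΦ (t - s)).scomp s ((hasDerivAt_id s).const_sub t)
      rw [neg_smul, one_smul] at h0
      exact h0
    have h2 := h1.hasDerivWithinAt.clm_apply (he s hs)
    convert h2 using 1
    simp
  -- The majorant `B` starts at the bound for ‖g(t₁)‖ and its derivative is the bound K M exp(-a(t -
  -- s)) for ‖Φ(t - s) f(s)‖.
  have key := image_norm_le_of_norm_deriv_right_le_deriv_boundary' (f := g)
    (f' := fun s => Φ (t - s) (f s)) (a := t₁) (b := t)
    (B := fun s => K * Real.exp (-a * (t - t₁)) * ‖e t₁‖ +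
      K * M / a * (Real.exp (-a * (t - s)) - Real.exp (-a * (t - t₁))))
    (B' := fun s => K * M * Real.exp (-a * (t - s)))
    (fun s hs => (hgd s hs).continuousWithinAt)
    (fun s hs => (hgd s ⟨hs.1, hs.2.le⟩).mono_of_mem_nhdsWithin
      (Icc_mem_nhdsGE_of_mem hs)) ?_ (by fun_prop) ?_ ?_ ⟨ht, le_rfl⟩
  · simp only [hg, sub_self, hΦ0, mul_zero, Real.exp_zero] at key
    refine key.trans (add_le_add_right ?_ _)
    have : 0 ≤ K * M / a := by positivity
    have h3 := Real.exp_pos (-a * (t - t₁))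
    nlinarith
  · simp only [sub_self, mul_zero, add_zero, hg]
    exact ((Φ (t - t₁)).le_opNorm _).trans
      (mul_le_mul_of_nonneg_right (hΦn _ (by linarith)) (norm_nonneg _))
  · intro s _
    have h1 : HasDerivAt (fun s => Real.exp (-a * (t - s))) (Real.exp (-a * (t - s)) * a) s := by
      have := (((hasDerivAt_id s).const_sub t).const_mul (-a)).exp
      simpa using this
    have h2 := ((h1.sub_const (Real.exp (-a * (t - t₁)))).const_mul (K * M / a)).const_add
      (K * Real.exp (-a * (t - t₁)) * ‖e t₁‖)
    have h3 : K * M * Real.exp (-a * (t - s)) = K * M / a * (Real.exp (-a * (t - s)) * a) := by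
      rw [div_mul_eq_mul_div, eq_div_iff ha.ne']
      ring
    rw [h3]
    exact h2.hasDerivWithinAt
  · intro s hs
    refine ((Φ (t - s)).le_opNorm _).trans ?_
    calc ‖Φ (t - s)‖ * ‖f s‖ ≤ (K * Real.exp (-a * (t - s))) * M :=
          mul_le_mul (hΦn _ (by linarith [hs.2])) (hM s ⟨hs.1, hs.2.le⟩) (norm_nonneg _)
            (by positivity)
      _ = _ := by ring

variable {L : E →L[ℝ] E} {Φ : ℝ → E →L[ℝ] E} {K a : ℝ} {e f : ℝ → E}

theorem exists_norm_le_of_forced_linear (ha : 0 < a)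
    (hK : 0 ≤ K) (hΦ0 : Φ 0 = 1) (hΦ : ∀ t, HasDerivAt Φ (Φ t * L) t)
    (hΦn : ∀ t, 0 ≤ t → ‖Φ t‖ ≤ K * Real.exp (-a * t))
    (he : ∀ s, 0 ≤ s → HasDerivWithinAt e (L (e s) + f s) (Ici 0) s)
    {M : ℝ} (hM : ∀ s, 0 ≤ s → ‖f s‖ ≤ M) : ∃ R : ℝ, ∀ t, 0 ≤ t → ‖e t‖ ≤ R := by
  refine ⟨K * ‖e 0‖ + K * M / a, fun t ht => ?_⟩
  have h := norm_le_of_forced_linear ha hK hΦ0 hΦ hΦn ht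
    (fun s hs => (he s hs.1).mono Icc_subset_Ici_self) (fun s hs => hM s hs.1)
  refine h.trans (add_le_add_left (mul_le_mul_of_nonneg_right ?_ (norm_nonneg _)) _)
  refine mul_le_of_le_one_right hK (Real.exp_le_one_iff.2 ?_)
  nlinarith

/-- Restart the input-to-state bound at a late time t₁: the memory of e(t₁) decays, and the input
after t₁ is as small as desired. -/
theorem tendsto_zero_of_forced_linear (ha : 0 < a)
    (hK : 0 ≤ K) (hΦ0 : Φ 0 = 1) (hΦ : ∀ t, HasDerivAt Φ (Φ t * L) t)
    (hΦn : ∀ t, 0 ≤ t → ‖Φ t‖ ≤ K * Real.exp (-a * t))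
    (he : ∀ s, 0 ≤ s → HasDerivWithinAt e (L (e s) + f s) (Ici 0) s)
    (hf : Tendsto f atTop (𝓝 0)) : Tendsto e atTop (𝓝 0) := by
  rw [NormedAddGroup.tendsto_nhds_zero]
  intro η hη
  -- With this M the asymptotic bound K M / a is below η / 2; K + 1 in place of K keeps the
  -- denominator positive.
  set M := η * a / (2 * (K + 1)) with hMdef
  have hMpos : 0 < M := by positivity
  obtain ⟨t₁, ht₁⟩ := eventually_atTop.1
    ((NormedAddGroup.tendsto_nhds_zero.1 hf M hMpos).and (eventually_ge_atTop 0))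
  have hlim : Tendsto (fun t => K * Real.exp (-a * (t - t₁)) * ‖e t₁‖ + K * M / a) atTop
      (𝓝 (K * 0 * ‖e t₁‖ + K * M / a)) := by
    refine Tendsto.add_const _ (Tendsto.mul_const _ (Tendsto.const_mul _ ?_))
    refine Real.tendsto_exp_atBot.comp ?_
    exact Tendsto.const_mul_atTop_of_neg (by linarith)
      (tendsto_atTop_add_const_right _ (-t₁) tendsto_id)
  have hlt : K * 0 * ‖e t₁‖ + K * M / a < η := by
    rw [hMdef]
    have : K * (η * a / (2 * (K + 1))) / a = η * (K / (2 * (K + 1))) := by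
      field_simp
    rw [this, mul_zero, zero_mul, zero_add]
    refine mul_lt_of_lt_one_right hη ?_
    rw [div_lt_one (by positivity)]
    linarith
  filter_upwards [hlim.eventually_lt_const hlt, eventually_ge_atTop t₁] with t h1 h2
  refine lt_of_le_of_lt ?_ h1
  have h0 := (ht₁ t₁ le_rfl).2
  exact norm_le_of_forced_linear ha hK hΦ0 hΦ hΦn h2
    (fun s hs => (he s (h0.trans hs.1)).mono fun r hr => h0.trans hr.1)
    (fun s hs => (ht₁ s hs.1).1.le)

end LinearODE

/-! ### Barbalat's lemma -/

section Barbalat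

/-- A Lipschitz function on `[0, ∞)` which is nonnegative and has bounded integrals tends to
zero. -/
theorem tendsto_zero_of_lipschitz_of_integral_le {f : ℝ → ℝ} {R K : ℝ} (hK : 0 ≤ K)
    (hf0 : ∀ t, 0 ≤ t → 0 ≤ f t)
    (hlip : ∀ s t, 0 ≤ s → s ≤ t → |f t - f s| ≤ K * (t - s))
    (hint : ∀ t, 0 ≤ t → ∫ s in (0 : ℝ)..t, f s ≤ R) : Tendsto f atTop (𝓝 0) := by
  have hcont : ContinuousOn f (Ici 0) := by
    have : LipschitzOnWith K.toNNReal f (Ici 0) := by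
      refine LipschitzOnWith.of_dist_le_mul fun x hx y hy => ?_
      rw [Real.coe_toNNReal _ hK, Real.dist_eq, Real.dist_eq]
      rcases le_total x y with h | h
      · rw [abs_sub_comm (f x), abs_sub_comm x, abs_of_nonneg (sub_nonneg.2 h)]
        exact hlip x y hx h
      · rw [abs_of_nonneg (sub_nonneg.2 h)]
        exact hlip y x hy h
    exact this.continuousOn
  have hii : ∀ s t, 0 ≤ s → 0 ≤ t → IntervalIntegrable f MeasureTheory.volume s t :=
    fun s t hs ht => (hcont.mono fun r hr => (le_min hs ht).trans hr.1).intervalIntegrable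
  -- The truncation `max t 0` makes the primitive monotone on the whole line, so that it converges
  -- to its supremum.
  set F : ℝ → ℝ := fun t => ∫ s in (0 : ℝ)..max t 0, f s with hF
  have hFdiff : ∀ s t, 0 ≤ s → 0 ≤ t → F t - F s = ∫ r in s..t, f r := by
    intro s t hs ht
    simp only [hF, max_eq_left hs, max_eq_left ht]
    exact intervalIntegral.integral_interval_sub_left (hii _ _ le_rfl ht) (hii _ _ le_rfl hs)
  have hmono : Monotone F := by
    intro s t hst
    have h1 : F t - F s = ∫ r in (max s 0)..(max t 0), f r := by
      have := hFdiff (max s 0) (max t 0) (le_max_right _ _) (le_max_right _ _)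
      simpa [hF] using this
    have h2 : 0 ≤ ∫ r in (max s 0)..(max t 0), f r :=
      intervalIntegral.integral_nonneg (max_le_max_right _ hst)
        fun u hu => hf0 u ((le_max_right _ _).trans hu.1)
    linarith
  have hbdd : BddAbove (range F) := ⟨R, by
    rintro _ ⟨t, rfl⟩
    exact hint _ (le_max_right _ _)⟩
  have hlim := tendsto_atTop_ciSup hmono hbdd
  rw [Metric.tendsto_atTop]
  intro η hη
  -- On a window of length h the function drops by at most K h ≤ η / 2. A value f(t) ≥ η would thus
  -- give an integral of at least h η / 2 over the window, whereas these integrals tend to 0.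
  set h := η / (2 * (K + 1)) with hh
  have hpos : 0 < h := by positivity
  have hd : Tendsto (fun t => F (t + h) - F t) atTop (𝓝 0) := by
    simpa using (hlim.comp (tendsto_atTop_add_const_right _ h tendsto_id)).sub hlim
  obtain ⟨N, hN⟩ := eventually_atTop.1
    ((hd.eventually_lt_const (show 0 < h * (η / 2) by positivity)).and (eventually_ge_atTop 0))
  refine ⟨N, fun t ht => ?_⟩
  obtain ⟨h1, h2⟩ := hN t ht
  rw [Real.dist_eq, sub_zero, abs_of_nonneg (hf0 t h2)]
  rw [hFdiff t (t + h) h2 (by linarith)] at h1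
  have h3 : ∫ _ in t..(t + h), (f t - K * h) ≤ ∫ r in t..(t + h), f r := by
    refine intervalIntegral.integral_mono_on (by linarith) intervalIntegrable_const
      (hii _ _ h2 (by linarith)) fun r hr => ?_
    have := (abs_le.1 (hlip t r h2 hr.1)).1
    nlinarith [hr.1, hr.2]
  rw [intervalIntegral.integral_const, smul_eq_mul, add_sub_cancel_left] at h3
  have h4 : f t - K * h < η / 2 := lt_of_mul_lt_mul_left (h3.trans_lt h1) hpos.le
  have h5 : K * h ≤ η / 2 := by
    rw [hh, ← mul_div_assoc, div_le_div_iff₀ (by positivity) two_pos]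
    nlinarith
  linarith

end Barbalat

/-! ### Passivity of periodic regimes by Fourier series -/

section FourierPassivity

open MeasureTheory

theorem fourierCoeffOn_add {T : ℝ} (hT : 0 < T) {f g : ℝ → ℂ} (hf : ContinuousOn f (Icc 0 T))
    (hg : ContinuousOn g (Icc 0 T)) (n : ℤ) :
    fourierCoeffOn hT (fun t => f t + g t) n = fourierCoeffOn hT f n + fourierCoeffOn hT g n := by
  have hc : Continuous fun x : ℝ => (fourier (-n) : C(AddCircle (T - 0), ℂ)) x :=
    (map_continuous _).comp (AddCircle.continuous_mk' _)
  simp only [fourierCoeffOn_eq_integral, smul_add]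
  rw [intervalIntegral.integral_add, smul_add]
  · exact (hc.continuousOn.smul (by rwa [uIcc_of_le hT.le])).intervalIntegrable
  · exact (hc.continuousOn.smul (by rwa [uIcc_of_le hT.le])).intervalIntegrable

theorem fourierCoeffOn_mulVec {κ S : Type*} [Fintype S] {T : ℝ} (hT : 0 < T) (M : Matrix κ S ℂ)
    {F : ℝ → S → ℂ} (hF : ContinuousOn F (Icc 0 T)) (i : κ) (n : ℤ) :
    fourierCoeffOn hT (fun t => M.mulVec (F t) i) n
      = M.mulVec (fun j => fourierCoeffOn hT (fun t => F t j) n) i := by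
  have hc : Continuous fun x : ℝ => (fourier (-n) : C(AddCircle (T - 0), ℂ)) x :=
    (map_continuous _).comp (AddCircle.continuous_mk' _)
  simp only [fourierCoeffOn_eq_integral, Matrix.mulVec, dotProduct, Finset.smul_sum]
  rw [intervalIntegral.integral_finsetSum, Finset.smul_sum]
  · refine Finset.sum_congr rfl fun j _ => ?_
    rw [← intervalIntegral.integral_smul, ← intervalIntegral.integral_smul,
      ← intervalIntegral.integral_const_mul]
    refine intervalIntegral.integral_congr fun t _ => ?_
    simp only [smul_eq_mul, Complex.real_smul]
    ring
  · intro j _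
    refine ContinuousOn.intervalIntegrable ?_
    rw [uIcc_of_le hT.le]
    exact hc.continuousOn.smul (continuousOn_const.mul (continuousOn_pi.1 hF j))

theorem _root_.ContinuousOn.matrix_mulVec_left {κ S : Type*} [Fintype S] {s : Set ℝ}
    {F : ℝ → S → ℂ} (hF : ContinuousOn F s) (M : Matrix κ S ℂ) :
    ContinuousOn (fun t => M.mulVec (F t)) s :=
  (Continuous.matrix_mulVec continuous_const continuous_id).comp_continuousOn hF

/-- Integration by parts, whose boundary term vanishes because the end values agree. At n = 0 the
claim is that f' has zero integral. -/
theorem fourierCoeffOn_deriv_of_periodic {T : ℝ} (hT : 0 < T) {f f' : ℝ → ℂ}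
    (hf : ContinuousOn f (Icc 0 T)) (hd : ∀ t ∈ Ioo 0 T, HasDerivAt f (f' t) t)
    (hf' : ContinuousOn f' (Icc 0 T)) (hper : f 0 = f T) (n : ℤ) :
    fourierCoeffOn hT f' n
      = (((2 * Real.pi * n / T : ℝ) : ℂ) * Complex.I) * fourierCoeffOn hT f n := by
  have hi : IntervalIntegrable f' volume 0 T :=
    ContinuousOn.intervalIntegrable (by rwa [uIcc_of_le hT.le])
  rcases eq_or_ne n 0 with rfl | hn
  · rw [fourierCoeffOn_eq_integral]
    have : ∫ t in (0 : ℝ)..T, f' t = 0 := by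
      rw [intervalIntegral.integral_eq_sub_of_hasDerivAt_of_le hT.le hf hd hi, hper, sub_self]
    simp [this]
  · have h := fourierCoeffOn_of_hasDerivAt_Ioo (f := f) (f' := f') hT hn (by rwa [uIcc_of_le hT.le])
      (by rwa [min_eq_left hT.le, max_eq_right hT.le]) hi
    rw [h, hper, sub_self, mul_zero]
    have hn' : (n : ℂ) ≠ 0 := by exact_mod_cast hn
    have hT' : (T : ℂ) ≠ 0 := by exact_mod_cast hT.ne'
    have hpi : (Real.pi : ℂ) ≠ 0 := by exact_mod_cast Real.pi_ne_zero
    push_cast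
    field_simp
    simp

/-- Parseval's identity, polarized. Only the real part of the pairing is needed, so f + g and f - g
suffice. -/
theorem hasSum_re_conj_fourierCoeffOn {T : ℝ} (hT : 0 < T) {f g : ℝ → ℂ}
    (hf : ContinuousOn f (Icc 0 T)) (hg : ContinuousOn g (Icc 0 T)) :
    HasSum (fun n => (star (fourierCoeffOn hT f n) * fourierCoeffOn hT g n).re)
      (T⁻¹ * ∫ t in (0 : ℝ)..T, (star (f t) * g t).re) := by
  have hpar : ∀ h : ℝ → ℂ, ContinuousOn h (Icc 0 T) →
      HasSum (fun n => ‖fourierCoeffOn hT h n‖ ^ 2) (T⁻¹ * ∫ t in (0 : ℝ)..T, ‖h t‖ ^ 2) := by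
    intro h hh
    have hm : MemLp h 2 (volume.restrict (Ioc 0 T)) := by
      obtain ⟨c, hc⟩ := isCompact_Icc.exists_bound_of_continuousOn hh
      refine MemLp.of_bound ((hh.mono Ioc_subset_Icc_self).aestronglyMeasurable
        measurableSet_Ioc) c ?_
      exact (ae_restrict_iff' measurableSet_Ioc).2
        (Eventually.of_forall fun t ht => hc t (Ioc_subset_Icc_self ht))
    simpa using hasSum_sq_fourierCoeffOn hT hm
  have hng : ContinuousOn (fun t => (-1 : ℂ) * g t) (Icc 0 T) := continuousOn_const.mul hg
  have h1 := hpar _ (hf.add hg)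
  have h2 := hpar _ (hf.add hng)
  have h3 := (h1.sub h2).mul_left (1 / 4)
  have hpol : ∀ a b : ℂ, 1 / 4 * (‖a + b‖ ^ 2 - ‖a + -1 * b‖ ^ 2) = (star a * b).re := by
    intro a b
    rw [← Complex.normSq_eq_norm_sq, ← Complex.normSq_eq_norm_sq]
    simp only [Complex.normSq_apply, Complex.add_re, Complex.add_im, Complex.mul_re,
      Complex.mul_im, Complex.neg_re, Complex.neg_im, Complex.one_re, Complex.one_im,
      Complex.star_def, Complex.conj_re, Complex.conj_im]
    ring
  have e1 : (fun n => (star (fourierCoeffOn hT f n) * fourierCoeffOn hT g n).re)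
      = fun n => 1 / 4 * (‖fourierCoeffOn hT (fun t => f t + g t) n‖ ^ 2
          - ‖fourierCoeffOn hT (fun t => f t + -1 * g t) n‖ ^ 2) := by
    funext n
    rw [fourierCoeffOn_add hT hf hg, fourierCoeffOn_add hT hf hng, fourierCoeffOn.const_mul, hpol]
  have e2 : (T⁻¹ * ∫ t in (0 : ℝ)..T, (star (f t) * g t).re)
      = 1 / 4 * ((T⁻¹ * ∫ t in (0 : ℝ)..T, ‖f t + g t‖ ^ 2)
        - T⁻¹ * ∫ t in (0 : ℝ)..T, ‖f t + -1 * g t‖ ^ 2) := by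
    rw [← mul_sub, ← intervalIntegral.integral_sub, mul_left_comm]
    · congr 1
      rw [← intervalIntegral.integral_const_mul]
      exact intervalIntegral.integral_congr fun t _ => (hpol _ _).symm
    · refine ContinuousOn.intervalIntegrable ?_
      rw [uIcc_of_le hT.le]
      exact (hf.add hg).norm.pow 2
    · refine ContinuousOn.intervalIntegrable ?_
      rw [uIcc_of_le hT.le]
      exact (hf.add hng).norm.pow 2
  rw [e1, e2]
  exact h3

variable {S ι : Type*} [Fintype S] [DecidableEq S] [Fintype ι]

theorem re_star_dotProduct_nonneg {H : ℂ → Matrix ι ι ℂ} (hH : IsStablePositiveReal H) (ω : ℝ)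
    (x : ι → ℂ) : 0 ≤ (star x ⬝ᵥ (H (ω * Complex.I)).mulVec x).re := by
  have h := (hH.2 ω).re_dotProduct_nonneg x
  set G := H (ω * Complex.I)
  rw [Matrix.add_mulVec, dotProduct_add, map_add] at h
  have e : star x ⬝ᵥ G.conjTranspose.mulVec x = star (star x ⬝ᵥ G.mulVec x) := by
    rw [Matrix.star_dotProduct, Matrix.star_mulVec, Matrix.conjTranspose_conjTranspose,
      ← Matrix.dotProduct_mulVec]
  rw [e] at h
  simp only [RCLike.re_to_complex, Complex.star_def, Complex.conj_re] at h
  linarith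

/-- A positive real system in a periodic regime absorbs energy over a period. -/
theorem integral_supply_nonneg_of_periodic {A : Matrix S S ℝ} {B : Matrix S ι ℝ}
    {C : Matrix ι S ℝ} {D : Matrix ι ι ℝ}
    (hA : ∀ (l : ℂ) (w : S → ℂ), w ≠ 0 → (toComplex A).mulVec w = l • w → l.re < 0)
    (hH : IsStablePositiveReal (transferMatrix A B C D)) {T : ℝ} (hT : 0 < T)
    {e : ℝ → S → ℂ} {w : ℝ → ι → ℂ} (hw : ContinuousOn w (Icc 0 T))
    (he : ∀ t ∈ Icc 0 T, HasDerivWithinAt e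
      ((toComplex A).mulVec (e t) + (toComplex B).mulVec (w t)) (Icc 0 T) t)
    (hper : e 0 = e T) :
    0 ≤ ∫ t in (0 : ℝ)..T,
      (star (w t) ⬝ᵥ ((toComplex C).mulVec (e t) + (toComplex D).mulVec (w t))).re := by
  have hec : ContinuousOn e (Icc 0 T) := fun t ht => (he t ht).continuousWithinAt
  set v : ℝ → ι → ℂ := fun t => (toComplex C).mulVec (e t) + (toComplex D).mulVec (w t) with hv
  have hvc : ContinuousOn v (Icc 0 T) := (hec.matrix_mulVec_left _).add (hw.matrix_mulVec_left _)
  have hsum : HasSum (fun n => ∑ i, (star (fourierCoeffOn hT (fun t => w t i) n)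
      * fourierCoeffOn hT (fun t => v t i) n).re)
      (∑ i, T⁻¹ * ∫ t in (0 : ℝ)..T, (star (w t i) * v t i).re) :=
    hasSum_sum fun i _ => hasSum_re_conj_fourierCoeffOn hT (continuousOn_pi.1 hw i)
      (continuousOn_pi.1 hvc i)
  have e1 : (∑ i, T⁻¹ * ∫ t in (0 : ℝ)..T, (star (w t i) * v t i).re)
      = T⁻¹ * ∫ t in (0 : ℝ)..T, (star (w t) ⬝ᵥ v t).re := by
    rw [← Finset.mul_sum, ← intervalIntegral.integral_finsetSum]
    · simp only [dotProduct, Pi.star_apply, Complex.re_sum]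
    · intro i _
      refine ContinuousOn.intervalIntegrable ?_
      rw [uIcc_of_le hT.le]
      exact Complex.continuous_re.comp_continuousOn
        ((continuous_star.comp_continuousOn (continuousOn_pi.1 hw i)).mul
          (continuousOn_pi.1 hvc i))
  rw [e1] at hsum
  have hnn : 0 ≤ T⁻¹ * ∫ t in (0 : ℝ)..T, (star (w t) ⬝ᵥ v t).re := by
    refine hsum.nonneg fun n => ?_
    set ω : ℝ := 2 * Real.pi * n / T with hω
    set we : ι → ℂ := fun i => fourierCoeffOn hT (fun t => w t i) n with hwe
    set ee : S → ℂ := fun i => fourierCoeffOn hT (fun t => e t i) n with hee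
    -- The state equation holds mode by mode. Only the state has to match at the end points; the
    -- input need not be periodic.
    have hstate : ((ω : ℂ) * Complex.I) • ee
        = (toComplex A).mulVec ee + (toComplex B).mulVec we := by
      funext j
      have h1 := fourierCoeffOn_deriv_of_periodic hT (f := fun t => e t j)
        (f' := fun t => (toComplex A).mulVec (e t) j + (toComplex B).mulVec (w t) j)
        (continuousOn_pi.1 hec j)
        (fun t ht => (hasDerivAt_pi.1
          ((he t (Ioo_subset_Icc_self ht)).hasDerivAt (Icc_mem_nhds ht.1 ht.2)) j))
        ((continuousOn_pi.1 (hec.matrix_mulVec_left _) j).add (continuousOn_pi.1 (hw.matrix_mulVec_left _) j))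
        (congrFun hper j) n
      rw [fourierCoeffOn_add hT (continuousOn_pi.1 (hec.matrix_mulVec_left _) j)
        (continuousOn_pi.1 (hw.matrix_mulVec_left _) j), fourierCoeffOn_mulVec hT _ hec,
        fourierCoeffOn_mulVec hT _ hw] at h1
      exact h1.symm
    have hunit : IsUnit (((ω : ℂ) * Complex.I) • (1 : Matrix S S ℂ) - toComplex A).det := by
      rw [isUnit_iff_ne_zero]
      intro h0
      obtain ⟨x, hx, hx0⟩ := Matrix.exists_mulVec_eq_zero_iff.2 h0
      rw [Matrix.sub_mulVec, Matrix.smul_mulVec, Matrix.one_mulVec, sub_eq_zero] at hx0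
      simpa using hA _ x hx hx0.symm
    -- As iω is not an eigenvalue of A, the state mode can be eliminated: the output mode is H(iω)
    -- applied to the input mode, and positive realness makes the Parseval term nonnegative.
    have hout : (fun i => fourierCoeffOn hT (fun t => v t i) n)
        = (transferMatrix A B C D (ω * Complex.I)).mulVec we := by
      have h2 : (((ω : ℂ) * Complex.I) • (1 : Matrix S S ℂ) - toComplex A).mulVec ee
          = (toComplex B).mulVec we := by
        rw [Matrix.sub_mulVec, Matrix.smul_mulVec, Matrix.one_mulVec, hstate, add_sub_cancel_left]
      have h3 : ee = ((((ω : ℂ) * Complex.I) • (1 : Matrix S S ℂ) - toComplex A)⁻¹).mulVec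
          ((toComplex B).mulVec we) := by
        rw [← h2, Matrix.mulVec_mulVec, Matrix.nonsing_inv_mul _ hunit, Matrix.one_mulVec]
      rw [transferMatrix, Matrix.add_mulVec, ← Matrix.mulVec_mulVec, ← Matrix.mulVec_mulVec, ← h3]
      funext i
      simp only [hv, Pi.add_apply]
      rw [fourierCoeffOn_add hT (continuousOn_pi.1 (hec.matrix_mulVec_left _) i)
        (continuousOn_pi.1 (hw.matrix_mulVec_left _) i), fourierCoeffOn_mulVec hT _ hec,
        fourierCoeffOn_mulVec hT _ hw]
    have h4 := re_star_dotProduct_nonneg hH ω we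
    rw [← hout] at h4
    simpa only [dotProduct, Pi.star_apply, Complex.re_sum, hwe] using h4
  exact nonneg_of_mul_nonneg_right hnn (inv_pos.2 hT)

end FourierPassivity

/-! ### Passivity from an arbitrary initial state -/

section Passivity

theorem exists_decaying_semigroup {E : Type*} [NormedAddCommGroup E] [NormedSpace ℂ E]
    [FiniteDimensional ℂ E] (L : E →L[ℂ] E)
    (hL : ∀ (l : ℂ) (w : E), w ≠ 0 → L w = l • w → l.re < 0) :
    ∃ (Φ : ℝ → E →L[ℝ] E) (K a : ℝ), 0 < K ∧ 0 < a ∧ Φ 0 = 1 ∧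
      (∀ t, HasDerivAt Φ (Φ t * L.restrictScalars ℝ) t) ∧ (∀ t x, Φ t (L x) = L (Φ t x)) ∧
      ∀ t, 0 ≤ t → ‖Φ t‖ ≤ K * Real.exp (-a * t) := by
  have : CompleteSpace E := FiniteDimensional.complete ℂ E
  obtain ⟨K, a, hK, ha, hbound⟩ := exists_forall_norm_exp_le_exp L hL
  let r := ContinuousLinearMap.restrictScalarsL ℂ E E ℝ ℝ
  refine ⟨fun t => r (NormedSpace.exp (t • L)), K, a, hK, ha, ?_, fun t => ?_, fun t x => ?_,
    fun t ht => ?_⟩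
  · simp only [zero_smul, NormedSpace.exp_zero]
    rfl
  · exact r.hasFDerivAt.comp_hasDerivAt t (hasDerivAt_exp_smul_const (𝕂 := ℝ) L t)
  · have hc : Commute (NormedSpace.exp (t • L)) L := ((Commute.refl L).smul_left t).exp_left
    exact congrArg (fun F : E →L[ℂ] E => F x) hc.eq
  · exact (ContinuousLinearMap.norm_restrictScalars _).le.trans (hbound t ht)

variable {S ι : Type*} [Fintype S] [Fintype ι]

/-- The operator `x ↦ M x` of a complex matrix. -/
noncomputable def mulVecOperator (M : Matrix S S ℂ) : (S → ℂ) →L[ℂ] (S → ℂ) :=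
  LinearMap.toContinuousLinearMap (Matrix.mulVecLin M)

theorem mulVecOperator_apply (M : Matrix S S ℂ) (x : S → ℂ) :
    mulVecOperator M x = M.mulVec x := rfl

theorem continuousOn_re_star_dotProduct {s : Set ℝ} {f g : ℝ → ι → ℂ} (hf : ContinuousOn f s)
    (hg : ContinuousOn g s) : ContinuousOn (fun t => (star (f t) ⬝ᵥ g t).re) s := by
  refine Complex.continuous_re.comp_continuousOn ?_
  simp only [dotProduct, Pi.star_apply]
  exact continuousOn_finsetSum _ fun i _ =>
    (continuous_star.comp_continuousOn (continuousOn_pi.1 hf i)).mul (continuousOn_pi.1 hg i)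

theorem abs_re_star_dotProduct_mulVec_le (C : Matrix ι S ℂ) (w : ι → ℂ) (y : S → ℂ) :
    |(star w ⬝ᵥ C.mulVec y).re| ≤ (∑ i, ∑ j, ‖C i j‖) * ‖w‖ * ‖y‖ := by
  refine (Complex.abs_re_le_norm _).trans ?_
  rw [dotProduct, Finset.sum_mul, Finset.sum_mul]
  refine (norm_sum_le _ _).trans (Finset.sum_le_sum fun i _ => ?_)
  rw [norm_mul, Pi.star_apply, norm_star, mul_comm, mul_right_comm]
  refine mul_le_mul ?_ (norm_le_pi_norm w i) (norm_nonneg _) (by positivity)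
  rw [Matrix.mulVec, dotProduct, Finset.sum_mul]
  refine (norm_sum_le _ _).trans (Finset.sum_le_sum fun j _ => ?_)
  rw [norm_mul]
  exact mul_le_mul_of_nonneg_left (norm_le_pi_norm y j) (norm_nonneg _)

variable [DecidableEq S]

/-- Passivity with an arbitrary initial state: along bounded inputs, the energy absorbed by a
stable positive real system is bounded below uniformly in the horizon. -/
theorem exists_le_integral_supply {A : Matrix S S ℝ} {B : Matrix S ι ℝ}
    {C : Matrix ι S ℝ} {D : Matrix ι ι ℝ}
    (hA : ∀ (l : ℂ) (w : S → ℂ), w ≠ 0 → (toComplex A).mulVec w = l • w → l.re < 0)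
    (hH : IsStablePositiveReal (transferMatrix A B C D))
    {e : ℝ → S → ℂ} {w : ℝ → ι → ℂ} (hw : ContinuousOn w (Ici 0)) {W R : ℝ}
    (hW : ∀ t, 0 ≤ t → ‖w t‖ ≤ W) (hR : ∀ t, 0 ≤ t → ‖e t‖ ≤ R)
    (he : ∀ t, 0 ≤ t → HasDerivWithinAt e
      ((toComplex A).mulVec (e t) + (toComplex B).mulVec (w t)) (Ici 0) t) :
    ∃ c : ℝ, ∀ T, 0 ≤ T → -c ≤ ∫ t in (0 : ℝ)..T,
      (star (w t) ⬝ᵥ ((toComplex C).mulVec (e t) + (toComplex D).mulVec (w t))).re := by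
  obtain ⟨Φ, K, a, hK, ha, hΦ0, hΦ, hcomm, hΦn⟩ := exists_decaying_semigroup
    (mulVecOperator (toComplex A)) hA
  have hec : ContinuousOn e (Ici 0) := fun t ht => (he t ht).continuousWithinAt
  have hΦc : Continuous Φ := continuous_iff_continuousAt.2 fun t => (hΦ t).continuousAt
  have hW0 : 0 ≤ W := (norm_nonneg _).trans (hW 0 le_rfl)
  have hR0 : 0 ≤ R := (norm_nonneg _).trans (hR 0 le_rfl)
  set cC : ℝ := ∑ i, ∑ j, ‖toComplex C i j‖ with hcC
  set cD : ℝ := ∑ i, ∑ j, ‖toComplex D i j‖ with hcD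
  have hcC0 : 0 ≤ cC := by positivity
  have hcD0 : 0 ≤ cD := by positivity
  set q : ℝ → ℝ := fun t =>
    (star (w t) ⬝ᵥ ((toComplex C).mulVec (e t) + (toComplex D).mulVec (w t))).re with hq
  have hlow : ∀ t, 0 ≤ t → -(cC * W * R + cD * W * W) ≤ q t := by
    intro t ht
    simp only [hq, dotProduct_add, Complex.add_re]
    have h1 := (abs_le.1 (abs_re_star_dotProduct_mulVec_le (toComplex C) (w t) (e t))).1
    have h2 := (abs_le.1 (abs_re_star_dotProduct_mulVec_le (toComplex D) (w t) (w t))).1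
    have h3 : cC * ‖w t‖ * ‖e t‖ ≤ cC * W * R :=
      mul_le_mul (mul_le_mul_of_nonneg_left (hW t ht) hcC0) (hR t ht) (norm_nonneg _)
        (by positivity)
    have h4 : cD * ‖w t‖ * ‖w t‖ ≤ cD * W * W :=
      mul_le_mul (mul_le_mul_of_nonneg_left (hW t ht) hcD0) (hW t ht) (norm_nonneg _)
        (by positivity)
    linarith
  -- Beyond T₀ the map 1 - Φ(T) is invertible with inverse of norm at most 2. Horizons up to T₀ are
  -- covered by the pointwise bound `hlow`.
  obtain ⟨T₀, hT₀0, hT₀⟩ : ∃ T₀ : ℝ, 0 < T₀ ∧ ∀ T, T₀ ≤ T → ‖Φ T‖ ≤ 1 / 2 := by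
    have hlim : Tendsto (fun t => K * Real.exp (-a * t)) atTop (𝓝 (K * 0)) :=
      Tendsto.const_mul _ (Real.tendsto_exp_atBot.comp
        (Tendsto.const_mul_atTop_of_neg (by linarith) tendsto_id))
    obtain ⟨N, hN⟩ := eventually_atTop.1
      ((hlim.eventually_lt_const (show K * 0 < 1 / 2 by norm_num)).and (eventually_gt_atTop 0))
    exact ⟨N, (hN N le_rfl).2, fun T hT => (hΦn T (hN T hT).2.le).trans (hN T hT).1.le⟩
  set k : ℝ := cC * W * (K * (4 * R)) with hk
  have hk0 : 0 ≤ k := by positivity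
  -- The first summand pays for horizons up to T₀, the second for the free motion added on longer
  -- ones.
  refine ⟨(cC * W * R + cD * W * W) * T₀ + k / a, fun T hT => ?_⟩
  rcases le_or_gt T T₀ with hTT | hTT
  · have h1 : ∫ _ in (0 : ℝ)..T, (-(cC * W * R + cD * W * W)) ≤ ∫ t in (0 : ℝ)..T, q t := by
      refine intervalIntegral.integral_mono_on hT intervalIntegrable_const ?_
        fun t ht => hlow t ht.1
      refine ContinuousOn.intervalIntegrable ?_
      rw [uIcc_of_le hT]
      exact (continuousOn_re_star_dotProduct hw ((hec.matrix_mulVec_left _).add (hw.matrix_mulVec_left _))).mono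
        Icc_subset_Ici_self
    rw [intervalIntegral.integral_const, smul_eq_mul, sub_zero] at h1
    have h2 : 0 ≤ cC * W * R + cD * W * W := by positivity
    have h3 : 0 ≤ k / a := by positivity
    nlinarith
  have hTpos : 0 < T := hT₀0.trans hTT
  have hhalf := hT₀ T hTT.le
  -- The initial correction d is chosen so that e + Φ d has equal values at 0 and T. It depends on
  -- T, but its norm is at most 4R.
  obtain ⟨d, hd⟩ : ∃ d, (1 - Φ T) d = e T - e 0 := by
    have hu : IsUnit (1 - Φ T) := isUnit_one_sub_of_norm_lt_one (by linarith)
    exact ((ContinuousLinearMap.isUnit_iff_bijective.1 hu).2 _)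
  have hdT : Φ T d = d - (e T - e 0) := by
    rw [← hd]
    simp
  have hdn : ‖d‖ ≤ 4 * R := by
    have h1 : ‖d‖ ≤ ‖Φ T d‖ + (‖e T‖ + ‖e 0‖) := by
      have : d = Φ T d + (e T - e 0) := by rw [hdT]; abel
      calc ‖d‖ = ‖Φ T d + (e T - e 0)‖ := by rw [← this]
        _ ≤ _ := (norm_add_le _ _).trans (by gcongr; exact norm_sub_le _ _)
    have h2 : ‖Φ T d‖ ≤ 1 / 2 * ‖d‖ :=
      ((Φ T).le_opNorm d).trans (mul_le_mul_of_nonneg_right hhalf (norm_nonneg _))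
    linarith [hR T hT, hR 0 le_rfl]
  have hΦd : ∀ t, HasDerivAt (fun t => Φ t d) ((toComplex A).mulVec (Φ t d)) t := by
    intro t
    have := (hΦ t).clm_apply (hasDerivAt_const t d)
    rw [map_zero, add_zero] at this
    rw [← mulVecOperator_apply, ← hcomm]
    exact this
  have hΦdc : Continuous fun t => Φ t d := hΦc.clm_apply continuous_const
  have hsub : Icc 0 T ⊆ Ici (0 : ℝ) := Icc_subset_Ici_self
  have hper := integral_supply_nonneg_of_periodic hA hH hTpos (e := fun t => e t + Φ t d)
    (hw.mono hsub) (fun t ht => by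
      have h1 := ((he t ht.1).mono hsub).add (hΦd t).hasDerivWithinAt
      have h2 : (toComplex A).mulVec (e t + Φ t d) + (toComplex B).mulVec (w t)
          = (toComplex A).mulVec (e t) + (toComplex B).mulVec (w t)
            + (toComplex A).mulVec (Φ t d) := by
        rw [Matrix.mulVec_add]
        abel
      rw [h2]
      exact h1) (by
      simp only [hΦ0, hdT, one_apply_eq_self]
      abel)
  set p : ℝ → ℝ := fun t => (star (w t) ⬝ᵥ (toComplex C).mulVec (Φ t d)).re with hp
  have hqi : IntervalIntegrable q MeasureTheory.volume 0 T := by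
    refine ContinuousOn.intervalIntegrable ?_
    rw [uIcc_of_le hT]
    exact (continuousOn_re_star_dotProduct hw ((hec.matrix_mulVec_left _).add (hw.matrix_mulVec_left _))).mono hsub
  have hpi : IntervalIntegrable p MeasureTheory.volume 0 T := by
    refine ContinuousOn.intervalIntegrable ?_
    rw [uIcc_of_le hT]
    exact (continuousOn_re_star_dotProduct hw (hΦdc.continuousOn.matrix_mulVec_left _)).mono hsub
  have hsplit : ∫ t in (0 : ℝ)..T, (star (w t) ⬝ᵥ ((toComplex C).mulVec (e t + Φ t d)
      + (toComplex D).mulVec (w t))).re = (∫ t in (0 : ℝ)..T, q t) + ∫ t in (0 : ℝ)..T, p t := by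
    rw [← intervalIntegral.integral_add hqi hpi]
    refine intervalIntegral.integral_congr fun t _ => ?_
    simp only [hq, hp, Matrix.mulVec_add, dotProduct_add, Complex.add_re]
    ring
  rw [hsplit] at hper
  -- The supply due to the free motion is dominated by a decaying exponential, so its integral is
  -- bounded independently of T.
  have hple : ∫ t in (0 : ℝ)..T, p t ≤ ∫ t in (0 : ℝ)..T, k * Real.exp (-a * t) := by
    refine intervalIntegral.integral_mono_on hT hpi
      (Continuous.intervalIntegrable (by fun_prop) _ _) fun t ht => ?_
    refine (le_abs_self _).trans ((abs_re_star_dotProduct_mulVec_le _ _ _).trans ?_)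
    have h1 : ‖Φ t d‖ ≤ K * Real.exp (-a * t) * (4 * R) :=
      ((Φ t).le_opNorm d).trans (mul_le_mul (hΦn t ht.1) hdn (norm_nonneg _) (by positivity))
    calc cC * ‖w t‖ * ‖Φ t d‖ ≤ cC * W * (K * Real.exp (-a * t) * (4 * R)) :=
          mul_le_mul (mul_le_mul_of_nonneg_left (hW t ht.1) hcC0) h1 (norm_nonneg _)
            (by positivity)
      _ = k * Real.exp (-a * t) := by rw [hk]; ring
  have hexp : ∫ t in (0 : ℝ)..T, k * Real.exp (-a * t) ≤ k / a := by
    have hder : ∀ t ∈ uIcc 0 T, HasDerivAt (fun t => -(k / a) * Real.exp (-a * t))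
        (k * Real.exp (-a * t)) t := by
      intro t _
      have h1 : HasDerivAt (fun t => Real.exp (-a * t)) (Real.exp (-a * t) * (-a * 1)) t :=
        ((hasDerivAt_id t).const_mul (-a)).exp
      have h2 : k * Real.exp (-a * t) = -(k / a) * (Real.exp (-a * t) * (-a * 1)) := by
        have : k / a * a = k := div_mul_cancel₀ _ ha.ne'
        linear_combination (-Real.exp (-a * t)) * this
      rw [h2]
      exact h1.const_mul (-(k / a))
    rw [intervalIntegral.integral_eq_sub_of_hasDerivAt hder
      (Continuous.intervalIntegrable (by fun_prop) _ _)]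
    have h2 : 0 ≤ k / a := by positivity
    have h3 := Real.exp_pos (-a * T)
    simp only [mul_zero, Real.exp_zero]
    nlinarith
  have h5 : 0 ≤ (cC * W * R + cD * W * W) * T₀ := by positivity
  linarith

end Passivity

/-! ### Entropy, soft maximum and the soft-max map -/

section Entropy

/-- The right-hand side is the Bregman divergence of x log x, whose second derivative 1/x is at
least 1 on (0, 1]. -/
theorem half_sq_le_relEntropy {a b : ℝ} (ha : 0 < a) (ha1 : a ≤ 1) (hb : 0 ≤ b) (hb1 : b ≤ 1) :
    (b - a) ^ 2 / 2 ≤ b * Real.log b - b * Real.log a - b + a := by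
  set g : ℝ → ℝ := fun x => x * Real.log x - x * Real.log a - x + a - (x - a) ^ 2 / 2 with hg
  have hga : g a = 0 := by simp [hg]
  have hcont : Continuous g := by
    have := Real.continuous_mul_log
    fun_prop
  have hder : ∀ x, 0 < x → HasDerivAt g (Real.log x - Real.log a - (x - a)) x := by
    intro x hx
    have h1 := (((((Real.hasDerivAt_mul_log hx.ne').sub
      ((hasDerivAt_id x).mul_const (Real.log a))).sub (hasDerivAt_id x)).add_const a).sub
      ((((hasDerivAt_id x).sub_const a).pow 2).div_const 2))
    refine h1.congr_deriv ?_
    simp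
    ring
  -- The logarithm has slope at least 1 on (0, 1]; this gives the sign of g' on either side of a.
  have key : ∀ x y : ℝ, 0 < x → x ≤ y → y ≤ 1 → y - x ≤ Real.log y - Real.log x := by
    intro x y hx hxy hy
    have hy0 := hx.trans_le hxy
    have h1 := Real.log_le_sub_one_of_pos (div_pos hx hy0)
    rw [Real.log_div hx.ne' hy0.ne'] at h1
    have h2 : y - x ≤ 1 - x / y := by
      have : 1 - x / y = (y - x) / y := by field_simp
      rw [this, le_div_iff₀ hy0]
      nlinarith
    linarith
  have hgb : 0 ≤ g b := by
    rw [← hga]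
    rcases le_total a b with h | h
    · refine monotoneOn_of_deriv_nonneg (convex_Icc a 1) hcont.continuousOn ?_ ?_ ⟨le_rfl, ha1⟩
        ⟨h, hb1⟩ h
      · intro x hx
        rw [interior_Icc] at hx
        exact (hder x (ha.trans hx.1)).differentiableAt.differentiableWithinAt
      · intro x hx
        rw [interior_Icc] at hx
        rw [(hder x (ha.trans hx.1)).deriv]
        linarith [key a x ha hx.1.le hx.2.le]
    · refine antitoneOn_of_deriv_nonpos (convex_Icc 0 a) hcont.continuousOn ?_ ?_ ⟨hb, h⟩
        ⟨ha.le, le_rfl⟩ h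
      · intro x hx
        rw [interior_Icc] at hx
        exact (hder x hx.1).differentiableAt.differentiableWithinAt
      · intro x hx
        rw [interior_Icc] at hx
        rw [(hder x hx.1).deriv]
        linarith [key x a hx.1 hx.2.le ha1]
  simp only [hg] at hgb
  linarith

variable {α : Type*} [Fintype α]

/-- The negative entropy `∑ yᵢ log yᵢ`. -/
noncomputable def negEntropy (y : α → ℝ) : ℝ := ∑ i, y i * Real.log (y i)

/-- The soft maximum `ε log ∑ exp (zᵢ / ε)`. -/
noncomputable def softMaximum (ε : ℝ) (z : α → ℝ) : ℝ :=
  ε * Real.log (∑ i, Real.exp (z i / ε))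

/-- The soft-max map of one player. -/
noncomputable def softmaxVec (ε : ℝ) (z : α → ℝ) : α → ℝ :=
  fun i => Real.exp (z i / ε) / ∑ j, Real.exp (z j / ε)

theorem le_one_of_mem_stdSimplex {y : α → ℝ} (hy : y ∈ stdSimplex ℝ α) (i : α) : y i ≤ 1 :=
  hy.2 ▸ Finset.single_le_sum (fun j _ => hy.1 j) (Finset.mem_univ i)

/-- Strong convexity of the negative entropy: the scalar divergence bound is applied from the
intermediate point m to both ends, and the linear terms cancel in the average. Positivity of y and t
> 0 keep m off the singularity of the logarithm, while x may lie on the boundary. -/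
theorem negEntropy_convexCombination_le {x y : α → ℝ} (hx : x ∈ stdSimplex ℝ α)
    (hy : y ∈ stdSimplex ℝ α) (hy0 : ∀ i, 0 < y i) {t : ℝ} (ht : 0 < t) (ht1 : t ≤ 1) :
    negEntropy (x + t • (y - x)) + t * (1 - t) / 2 * ((y - x) ⬝ᵥ (y - x))
      ≤ (1 - t) * negEntropy x + t * negEntropy y := by
  simp only [negEntropy, dotProduct, Finset.mul_sum, ← Finset.sum_add_distrib]
  refine Finset.sum_le_sum fun i _ => ?_
  simp only [Pi.add_apply, Pi.smul_apply, Pi.sub_apply, smul_eq_mul]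
  have hx0 := hx.1 i
  have hx1 := le_one_of_mem_stdSimplex hx i
  have hy1 := le_one_of_mem_stdSimplex hy i
  have hyi := hy0 i
  set m := x i + t * (y i - x i) with hm
  have hm0 : 0 < m := by
    have : m = (1 - t) * x i + t * y i := by rw [hm]; ring
    rw [this]
    have := mul_pos ht hyi
    have := mul_nonneg (sub_nonneg.2 ht1) hx0
    linarith
  have hm1 : m ≤ 1 := by
    have : m = (1 - t) * x i + t * y i := by rw [hm]; ring
    rw [this]
    nlinarith
  have h1 := mul_le_mul_of_nonneg_left (half_sq_le_relEntropy hm0 hm1 hx0 hx1)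
    (sub_nonneg.2 ht1)
  have h2 := mul_le_mul_of_nonneg_left (half_sq_le_relEntropy hm0 hm1 hyi.le hy1) ht.le
  have e1 : (1 - t) * ((x i - m) ^ 2 / 2) + t * ((y i - m) ^ 2 / 2)
      = t * (1 - t) / 2 * ((y i - x i) * (y i - x i)) := by
    rw [hm]; ring
  have e2 : (1 - t) * (x i * Real.log (x i) - x i * Real.log m - x i + m)
      + t * (y i * Real.log (y i) - y i * Real.log m - y i + m)
      = (1 - t) * (x i * Real.log (x i)) + t * (y i * Real.log (y i)) - m * Real.log m := by
    rw [hm]; ring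
  linarith

theorem continuous_negEntropy : Continuous (negEntropy : (α → ℝ) → ℝ) :=
  continuous_finsetSum _ fun i _ => Real.continuous_mul_log.comp (continuous_apply i)

variable [Nonempty α]

theorem sum_exp_pos (ε : ℝ) (z : α → ℝ) : 0 < ∑ i, Real.exp (z i / ε) :=
  Finset.sum_pos (fun _ _ => Real.exp_pos _) Finset.univ_nonempty

theorem softmaxVec_pos (ε : ℝ) (z : α → ℝ) (i : α) : 0 < softmaxVec ε z i :=
  div_pos (Real.exp_pos _) (sum_exp_pos ε z)

theorem softmaxVec_mem (ε : ℝ) (z : α → ℝ) : softmaxVec ε z ∈ stdSimplex ℝ α :=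
  ⟨fun i => (softmaxVec_pos ε z i).le, by
    simp only [softmaxVec]
    rw [← Finset.sum_div, div_self (sum_exp_pos ε z).ne']⟩

theorem mul_log_softmaxVec {ε : ℝ} (hε : 0 < ε) (z : α → ℝ) (i : α) :
    ε * Real.log (softmaxVec ε z i) = z i - softMaximum ε z := by
  rw [softmaxVec, Real.log_div (Real.exp_pos _).ne' (sum_exp_pos ε z).ne', Real.log_exp,
    softMaximum]
  field_simp

theorem softMaximum_eq {ε : ℝ} (hε : 0 < ε) (z : α → ℝ) :
    softMaximum ε z = z ⬝ᵥ softmaxVec ε z - ε * negEntropy (softmaxVec ε z) := by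
  have h : ∀ i, softmaxVec ε z i * softMaximum ε z
      = z i * softmaxVec ε z i - ε * (softmaxVec ε z i * Real.log (softmaxVec ε z i)) := by
    intro i
    linear_combination (softmaxVec ε z i) * mul_log_softmaxVec hε z i
  rw [dotProduct, negEntropy, Finset.mul_sum, ← Finset.sum_sub_distrib,
    ← Finset.sum_congr rfl fun i _ => h i, ← Finset.sum_mul, (softmaxVec_mem ε z).2, one_mul]

/-- Fenchel–Young inequality with quadratic remainder. The gap between the two sides of the plain
inequality is ε times the relative entropy of y with respect to the soft-max of z, which
`half_sq_le_relEntropy` bounds below. -/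
theorem le_softMaximum {ε : ℝ} (hε : 0 < ε) (z : α → ℝ) {y : α → ℝ} (hy : y ∈ stdSimplex ℝ α) :
    z ⬝ᵥ y - ε * negEntropy y + ε / 2 * ((y - softmaxVec ε z) ⬝ᵥ (y - softmaxVec ε z))
      ≤ softMaximum ε z := by
  set s := softmaxVec ε z with hs
  have h : ∀ i, ε / 2 * ((y i - s i) * (y i - s i)) ≤
      y i * softMaximum ε z - z i * y i + ε * (y i * Real.log (y i))
        + ε * (s i - y i) := by
    intro i
    have h1 := half_sq_le_relEntropy (softmaxVec_pos ε z i)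
      (le_one_of_mem_stdSimplex (softmaxVec_mem ε z) i) (hy.1 i) (le_one_of_mem_stdSimplex hy i)
    have h2 := mul_log_softmaxVec hε z i
    rw [← hs] at h1 h2
    have h3 := mul_le_mul_of_nonneg_left h1 hε.le
    have h4 : ε * (y i * Real.log (s i)) = y i * (z i - softMaximum ε z) := by
      rw [← h2]; ring
    linarith
  have h5 := Finset.sum_le_sum fun i (_ : i ∈ Finset.univ) => h i
  simp only [Finset.sum_add_distrib, Finset.sum_sub_distrib, ← Finset.mul_sum, ← Finset.sum_mul,
    hy.2, (softmaxVec_mem ε z).2, hs, one_mul, sub_self, mul_zero, add_zero] at h5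
  simp only [dotProduct, negEntropy, Pi.sub_apply]
  linarith

/-- Add the two quadratic Fenchel–Young inequalities obtained by testing each score vector against
the soft-max of the other. -/
theorem softmaxVec_cocoercive {ε : ℝ} (hε : 0 < ε) (z z' : α → ℝ) :
    ε * ((softmaxVec ε z - softmaxVec ε z') ⬝ᵥ (softmaxVec ε z - softmaxVec ε z'))
      ≤ (z - z') ⬝ᵥ (softmaxVec ε z - softmaxVec ε z') := by
  have h1 := le_softMaximum hε z (softmaxVec_mem ε z')
  have h2 := le_softMaximum hε z' (softmaxVec_mem ε z)
  rw [softMaximum_eq hε] at h1 h2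
  have h3 : (softmaxVec ε z' - softmaxVec ε z) ⬝ᵥ (softmaxVec ε z' - softmaxVec ε z)
      = (softmaxVec ε z - softmaxVec ε z') ⬝ᵥ (softmaxVec ε z - softmaxVec ε z') := by
    rw [← neg_sub, neg_dotProduct, dotProduct_neg, neg_neg]
  rw [h3] at h1
  have h4 : (z - z') ⬝ᵥ (softmaxVec ε z - softmaxVec ε z')
      = z ⬝ᵥ softmaxVec ε z - z ⬝ᵥ softmaxVec ε z' - z' ⬝ᵥ softmaxVec ε z
        + z' ⬝ᵥ softmaxVec ε z' := by
    simp only [sub_dotProduct, dotProduct_sub]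
    ring
  rw [h4]
  linarith

theorem dotProduct_softmaxVec_sub_le {ε : ℝ} (hε : 0 < ε) (z z' : α → ℝ) :
    (z - z') ⬝ᵥ (softmaxVec ε z - softmaxVec ε z') ≤ (z - z') ⬝ᵥ (z - z') / ε := by
  have h1 := softmaxVec_cocoercive hε z z'
  set a := z - z'
  set b := softmaxVec ε z - softmaxVec ε z'
  have h2 : 0 ≤ (a - ε • b) ⬝ᵥ (a - ε • b) := Finset.sum_nonneg fun _ _ => mul_self_nonneg _
  have h3 : (a - ε • b) ⬝ᵥ (a - ε • b) = a ⬝ᵥ a - 2 * ε * (a ⬝ᵥ b) + ε ^ 2 * (b ⬝ᵥ b) := by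
    simp only [sub_dotProduct, dotProduct_sub, smul_dotProduct, dotProduct_smul, smul_eq_mul,
      dotProduct_comm b a]
    ring
  rw [h3] at h2
  rw [le_div_iff₀ hε]
  nlinarith

theorem continuous_softMaximum (ε : ℝ) : Continuous (softMaximum ε : (α → ℝ) → ℝ) := by
  unfold softMaximum
  refine continuous_const.mul (Continuous.log (by fun_prop) fun z => (sum_exp_pos ε z).ne')

theorem continuous_softmaxVec (ε : ℝ) : Continuous (softmaxVec ε : (α → ℝ) → α → ℝ) := by
  refine continuous_pi fun i => ?_
  unfold softmaxVec
  exact Continuous.div (by fun_prop) (by fun_prop) fun z => (sum_exp_pos ε z).ne'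

theorem hasDerivWithinAt_softMaximum {ε : ℝ} (hε : 0 < ε) {z : ℝ → α → ℝ} {z' : α → ℝ}
    {s : Set ℝ} {t : ℝ} (hz : HasDerivWithinAt z z' s t) :
    HasDerivWithinAt (fun t => softMaximum ε (z t)) (softmaxVec ε (z t) ⬝ᵥ z') s t := by
  have h1 : HasDerivWithinAt (fun t => ∑ i, Real.exp (z t i / ε))
      (∑ i, Real.exp (z t i / ε) * (z' i / ε)) s t :=
    HasDerivWithinAt.fun_sum fun i _ => ((hasDerivWithinAt_pi.1 hz i).div_const ε).exp
  have h2 := (h1.log (sum_exp_pos ε (z t)).ne').const_mul ε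
  have h3 : softmaxVec ε (z t) ⬝ᵥ z'
      = ε * ((∑ i, Real.exp (z t i / ε) * (z' i / ε)) / ∑ i, Real.exp (z t i / ε)) := by
    rw [dotProduct, Finset.sum_div, Finset.mul_sum]
    refine Finset.sum_congr rfl fun i _ => ?_
    rw [softmaxVec]
    field_simp
  rw [h3]
  exact h2

end Entropy

/-! ### Nash distributions and existence of a fixed point -/

section Game

variable {P : Type*} {𝒜 : P → Type*}

theorem strategySpace_eq_pi [∀ p, Fintype (𝒜 p)] :
    strategySpace 𝒜 = univ.pi fun p => stdSimplex ℝ (𝒜 p) := by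
  ext x
  simp [strategySpace]

theorem isCompact_strategySpace [∀ p, Fintype (𝒜 p)] : IsCompact (strategySpace 𝒜) := by
  rw [strategySpace_eq_pi]
  exact isCompact_univ_pi fun p => isCompact_stdSimplex ℝ (𝒜 p)

theorem convex_strategySpace [∀ p, Fintype (𝒜 p)] : Convex ℝ (strategySpace 𝒜) := by
  rw [strategySpace_eq_pi]
  exact convex_pi fun p _ => convex_stdSimplex ℝ (𝒜 p)

theorem softmax_apply [∀ p, Fintype (𝒜 p)] (ε : ℝ) (z : ∀ p, 𝒜 p → ℝ) (p : P) :
    softmax ε z p = softmaxVec ε (z p) := rfl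

theorem softmax_mem [∀ p, Fintype (𝒜 p)] [∀ p, Nonempty (𝒜 p)] (ε : ℝ) (z : ∀ p, 𝒜 p → ℝ) :
    softmax ε z ∈ strategySpace 𝒜 :=
  fun p => softmaxVec_mem ε (z p)

theorem continuous_softmax [∀ p, Fintype (𝒜 p)] [∀ p, Nonempty (𝒜 p)] (ε : ℝ) :
    Continuous (softmax ε : (∀ p, 𝒜 p → ℝ) → ∀ p, 𝒜 p → ℝ) :=
  continuous_pi fun p => (continuous_softmaxVec ε).comp (continuous_apply p)

variable [Fintype P] [DecidableEq P]

theorem prod_update_apply (x : ∀ q, 𝒜 q → ℝ) (p : P) (y : 𝒜 p → ℝ) (a : ∀ q, 𝒜 q) :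
    ∏ q, Function.update x p y q (a q) = y (a p) * ∏ q ∈ Finset.univ.erase p, x q (a q) := by
  rw [← Finset.mul_prod_erase _ _ (Finset.mem_univ p), Function.update_self]
  congr 1
  refine Finset.prod_congr rfl fun q hq => ?_
  rw [Function.update_of_ne (Finset.ne_of_mem_erase hq)]

variable [∀ p, Fintype (𝒜 p)] [∀ p, DecidableEq (𝒜 p)]

theorem expectedPayoff_update (u : P → (∀ q, 𝒜 q) → ℝ) (p : P) (x : ∀ q, 𝒜 q → ℝ)
    (y : 𝒜 p → ℝ) :
    expectedPayoff u p (Function.update x p y) = payoffMap u x p ⬝ᵥ y := by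
  simp only [payoffMap, expectedPayoff, dotProduct, prod_update_apply, Finset.sum_mul]
  rw [Finset.sum_comm]
  refine Finset.sum_congr rfl fun a _ => ?_
  rw [Finset.sum_eq_single (a p)]
  · simp only [Pi.single_eq_same]
    ring
  · intro i _ hi
    simp [Pi.single_eq_of_ne hi.symm]
  · simp

theorem expectedPayoff_eq (u : P → (∀ q, 𝒜 q) → ℝ) (p : P) (x : ∀ q, 𝒜 q → ℝ) :
    expectedPayoff u p x = payoffMap u x p ⬝ᵥ x p := by
  rw [← expectedPayoff_update, Function.update_eq_self]

theorem contDiff_payoffMap (u : P → (∀ q, 𝒜 q) → ℝ) : ContDiff ℝ 1 (payoffMap u) := by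
  refine contDiff_pi.2 fun p => contDiff_pi.2 fun i => ?_
  simp only [payoffMap, expectedPayoff, prod_update_apply]
  exact ContDiff.sum fun a _ => contDiff_const.mul (contDiff_const.mul
    (contDiff_prod fun q _ => contDiff_pi.1 (contDiff_pi.1 contDiff_id q) (a q)))

variable [∀ p, Nonempty (𝒜 p)]

/-- The payoff of a player is linear in the player's own strategy, with coefficients U(x) that here
equal z. By Fenchel–Young the soft-max of these coefficients maximizes the perturbed payoff. -/
theorem isNashDistribution_of_fixedPoint (u : P → (∀ q, 𝒜 q) → ℝ) {ε : ℝ} (hε : 0 < ε)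
    {z : ∀ p, 𝒜 p → ℝ} (hz : payoffMap u (softmax ε z) = z) :
    IsNashDistribution u ε (softmax ε z) := by
  refine ⟨softmax_mem ε z, fun p y hy => ?_⟩
  simp only [perturbedPayoff, Function.update_self]
  rw [expectedPayoff_update, expectedPayoff_eq, hz, softmax_apply]
  have h1 := le_softMaximum hε (z p) hy
  rw [softMaximum_eq hε] at h1
  have h2 : 0 ≤ (y - softmaxVec ε (z p)) ⬝ᵥ (y - softmaxVec ε (z p)) :=
    Finset.sum_nonneg fun _ _ => mul_self_nonneg _
  have h3 : 0 ≤ ε / 2 * ((y - softmaxVec ε (z p)) ⬝ᵥ (y - softmaxVec ε (z p))) := by positivity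
  simp only [negEntropy] at h1
  linarith

/-- The duality gap of the entropy-perturbed game. -/
noncomputable def dualityGap (u : P → (∀ q, 𝒜 q) → ℝ) (ε : ℝ) (x : ∀ q, 𝒜 q → ℝ) : ℝ :=
  ∑ p, (softMaximum ε (payoffMap u x p) - payoffMap u x p ⬝ᵥ x p + ε * negEntropy (x p))

theorem continuous_dualityGap (u : P → (∀ q, 𝒜 q) → ℝ) (ε : ℝ) :
    Continuous (dualityGap u ε) := by
  have hU := (contDiff_payoffMap u).continuous
  refine continuous_finsetSum _ fun p _ => ?_
  have hUp : Continuous fun x => payoffMap u x p := (continuous_apply p).comp hU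
  exact (((continuous_softMaximum ε).comp hUp).sub
    (hUp.dotProduct (continuous_apply p))).add
      (continuous_const.mul (continuous_negEntropy.comp (continuous_apply p)))

/-- Change of one player's duality gap under a step t towards the soft-max response, when payoffs
move from U to U'. The soft maximum grows by at most (U' - U)·σ(U) + |U' - U|²/ε. Strong convexity
of the entropy gains ε t(1 - t)/2 |d|², and the old gap, at least ε/2 |d|², is removed in proportion
t; together they give the last term. -/
theorem softMaximum_gap_step {α : Type*} [Fintype α] [Nonempty α] {ε : ℝ} (hε : 0 < ε)
    (U U' : α → ℝ) {x : α → ℝ} (hx : x ∈ stdSimplex ℝ α) {t : ℝ} (ht : 0 < t) (ht1 : t ≤ 1) :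
    let d := softmaxVec ε U - x
    (softMaximum ε U' - U' ⬝ᵥ (x + t • d) + ε * negEntropy (x + t • d))
      - (softMaximum ε U - U ⬝ᵥ x + ε * negEntropy x)
      ≤ (U' - U) ⬝ᵥ (U' - U) / ε + (1 - t) * ((U' - U) ⬝ᵥ d) - t * ε * (1 - t / 2) * (d ⬝ᵥ d) := by
  intro d
  have hd : softmaxVec ε U - x = d := rfl
  have h1 := negEntropy_convexCombination_le hx (softmaxVec_mem ε U) (softmaxVec_pos ε U) ht ht1
  rw [hd] at h1
  have h2 := le_softMaximum hε U (softmaxVec_mem ε U')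
  have h2' : 0 ≤ ε / 2 * ((softmaxVec ε U' - softmaxVec ε U) ⬝ᵥ
      (softmaxVec ε U' - softmaxVec ε U)) :=
    mul_nonneg (by positivity) (Finset.sum_nonneg fun _ _ => mul_self_nonneg _)
  have h3 := le_softMaximum hε U hx
  have h3' : (x - softmaxVec ε U) ⬝ᵥ (x - softmaxVec ε U) = d ⬝ᵥ d := by
    rw [← hd, ← neg_sub, neg_dotProduct, dotProduct_neg, neg_neg]
  rw [h3'] at h3
  have h4 := dotProduct_softmaxVec_sub_le hε U' U
  have h5 := softMaximum_eq hε U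
  have h6 := softMaximum_eq hε U'
  have hs : softmaxVec ε U = x + d := by rw [← hd]; abel
  have e1 : U ⬝ᵥ softmaxVec ε U = U ⬝ᵥ x + U ⬝ᵥ d := by rw [hs, dotProduct_add]
  have e2 : U' ⬝ᵥ softmaxVec ε U = U' ⬝ᵥ x + U' ⬝ᵥ d := by rw [hs, dotProduct_add]
  have e3 : U' ⬝ᵥ (x + t • d) = U' ⬝ᵥ x + t * U' ⬝ᵥ d := by
    rw [dotProduct_add, dotProduct_smul, smul_eq_mul]
  have e4 : (U' - U) ⬝ᵥ (softmaxVec ε U' - softmaxVec ε U)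
      = U' ⬝ᵥ softmaxVec ε U' - U' ⬝ᵥ softmaxVec ε U - U ⬝ᵥ softmaxVec ε U'
        + U ⬝ᵥ softmaxVec ε U := by
    simp only [sub_dotProduct, dotProduct_sub]
    ring
  have e5 : (U' - U) ⬝ᵥ d = U' ⬝ᵥ d - U ⬝ᵥ d := sub_dotProduct _ _ _
  rw [e4] at h4
  rw [e1] at h5
  have h7 := mul_le_mul_of_nonneg_left h3 ht.le
  have h8 := mul_le_mul_of_nonneg_left h1 hε.le
  have h9 : t * softMaximum ε U
      = t * (U ⬝ᵥ x + U ⬝ᵥ d - ε * negEntropy (softmaxVec ε U)) := by rw [h5]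
  rw [e3, e5]
  nlinarith

/-- The fixed points of `U ∘ σ` exist when `-U` is `μ`-hypo-monotone with `μ < ε`. -/
theorem exists_fixedPoint (u : P → (∀ q, 𝒜 q) → ℝ) {ε μ : ℝ} (hμ : 0 < μ) (hμε : μ < ε)
    (hm : NegPayoffHypoMonotone u μ) : ∃ z : ∀ p, 𝒜 p → ℝ, payoffMap u (softmax ε z) = z := by
  have hε := hμ.trans hμε
  -- At a minimizer x of the duality gap, the displacement d to the soft-max response to U(x) turns
  -- out to vanish.
  obtain ⟨x, hx, hmin⟩ := (isCompact_strategySpace (𝒜 := 𝒜)).exists_isMinOn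
    ⟨softmax ε 0, softmax_mem ε 0⟩ (continuous_dualityGap u ε).continuousOn
  obtain ⟨K, hK⟩ := (contDiff_payoffMap u).contDiffOn.exists_lipschitzOnWith one_ne_zero
    (convex_strategySpace (𝒜 := 𝒜)) isCompact_strategySpace
  set y := softmax ε (payoffMap u x) with hy
  set d := y - x with hd
  set Q : ℝ := ∑ p, d p ⬝ᵥ d p with hQ
  have hQ0 : 0 ≤ Q := Finset.sum_nonneg fun p _ => Finset.sum_nonneg fun _ _ => mul_self_nonneg _
  set c : ℝ := ∑ p : P, ∑ _i : 𝒜 p, (K * ‖d‖) ^ 2 with hc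
  -- Minimality against x + t d: hypo-monotonicity bounds the interaction term by μ t Q, against a
  -- gain of ε t Q. Everything else is of order t², the quadratic payoff term by the Lipschitz bound
  -- contained in c.
  have hstep : ∀ t, 0 < t → t ≤ 1 → (ε - μ) * Q ≤ t * (c / ε + ε / 2 * Q) := by
    intro t ht ht1
    have hxt : x + t • d ∈ strategySpace 𝒜 := by
      have := convex_strategySpace (𝒜 := 𝒜) hx (softmax_mem ε (payoffMap u x))
        (sub_nonneg.2 ht1) ht.le (by ring)
      convert this using 1
      rw [hd]
      module
    have h1 : dualityGap u ε x ≤ dualityGap u ε (x + t • d) := hmin hxt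
    have h2 : dualityGap u ε (x + t • d) - dualityGap u ε x
        ≤ ∑ p, ((payoffMap u (x + t • d) p - payoffMap u x p) ⬝ᵥ
            (payoffMap u (x + t • d) p - payoffMap u x p) / ε
          + (1 - t) * ((payoffMap u (x + t • d) p - payoffMap u x p) ⬝ᵥ d p)
          - t * ε * (1 - t / 2) * (d p ⬝ᵥ d p)) := by
      rw [dualityGap, dualityGap, ← Finset.sum_sub_distrib]
      exact Finset.sum_le_sum fun p _ => softMaximum_gap_step hε _ _ (hx p) ht ht1
    rw [Finset.sum_sub_distrib, Finset.sum_add_distrib, ← Finset.sum_div, ← Finset.mul_sum,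
      ← Finset.mul_sum] at h2
    have h3 : (1 - t) * ∑ p, (payoffMap u (x + t • d) p - payoffMap u x p) ⬝ᵥ d p
        ≤ (1 - t) * (μ * t * Q) := by
      refine mul_le_mul_of_nonneg_left ?_ (sub_nonneg.2 ht1)
      have h4 := hm _ hxt _ hx
      have e1 : ∀ p, (x + t • d) p - x p = t • d p := fun p => by simp
      simp only [e1, smul_dotProduct, dotProduct_smul, smul_eq_mul, ← Finset.mul_sum] at h4
      simp only [dotProduct_comm _ (d _)]
      have h5 : t * (∑ p, d p ⬝ᵥ (payoffMap u (x + t • d) p - payoffMap u x p))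
          ≤ t * (μ * t * Q) := by
        rw [hQ]
        linarith
      exact le_of_mul_le_mul_left h5 ht
    have h6 : (∑ p, (payoffMap u (x + t • d) p - payoffMap u x p) ⬝ᵥ
        (payoffMap u (x + t • d) p - payoffMap u x p)) ≤ t ^ 2 * c := by
      simp only [hc, dotProduct, Finset.mul_sum]
      refine Finset.sum_le_sum fun p _ => Finset.sum_le_sum fun i _ => ?_
      have h7 := hK.dist_le_mul _ hxt _ hx
      rw [dist_eq_norm, dist_eq_norm, add_sub_cancel_left, norm_smul,
        Real.norm_of_nonneg ht.le] at h7
      have h8 : |(payoffMap u (x + t • d) p - payoffMap u x p) i| ≤ t * (K * ‖d‖) := by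
        calc _ ≤ ‖payoffMap u (x + t • d) - payoffMap u x‖ :=
              (norm_le_pi_norm (payoffMap u (x + t • d) p - payoffMap u x p) i).trans
                (norm_le_pi_norm (payoffMap u (x + t • d) - payoffMap u x) p)
          _ ≤ _ := h7.trans (le_of_eq (by ring))
      have h9 := abs_le.1 h8
      rw [← mul_pow, ← sq]
      exact sq_le_sq' h9.1 h9.2
    have h7 : (∑ p, (payoffMap u (x + t • d) p - payoffMap u x p) ⬝ᵥ
        (payoffMap u (x + t • d) p - payoffMap u x p)) / ε ≤ t ^ 2 * c / ε :=
      div_le_div_of_nonneg_right h6 hε.le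
    have h8 : 0 ≤ t ^ 2 * c / ε + (1 - t) * (μ * t * Q) - t * ε * (1 - t / 2) * Q := by
      linarith
    have h9 : t * ((ε - μ) * Q) ≤ t * (t * (c / ε + ε / 2 * Q)) := by
      have e1 : t ^ 2 * c / ε = t * (t * (c / ε)) := by ring
      have : 0 ≤ t * (t * μ * Q) := by positivity
      rw [e1] at h8
      nlinarith
    exact le_of_mul_le_mul_left h9 ht
  have hQle : (ε - μ) * Q ≤ 0 := by
    have hlim : Tendsto (fun t : ℝ => t * (c / ε + ε / 2 * Q)) (𝓝[>] 0) (𝓝 0) := by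
      have : Tendsto (fun t : ℝ => t * (c / ε + ε / 2 * Q)) (𝓝 0)
          (𝓝 (0 * (c / ε + ε / 2 * Q))) := tendsto_id.mul_const _
      rw [zero_mul] at this
      exact this.mono_left nhdsWithin_le_nhds
    refine ge_of_tendsto hlim ?_
    filter_upwards [Ioc_mem_nhdsGT (zero_lt_one' ℝ)] with t ht
    exact hstep t ht.1 ht.2
  have hQz : Q = 0 := by nlinarith
  have hyx : y = x := by
    rw [← sub_eq_zero]
    funext p i
    have h1 := (Finset.sum_eq_zero_iff_of_nonneg fun p _ =>
      Finset.sum_nonneg fun _ _ => mul_self_nonneg _).1 hQz p (Finset.mem_univ p)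
    exact mul_self_eq_zero.1 ((Finset.sum_eq_zero_iff_of_nonneg fun _ _ =>
      mul_self_nonneg _).1 h1 i (Finset.mem_univ i))
  exact ⟨payoffMap u x, by rw [← hy, hyx]⟩

end Game

/-! ### Families of real vectors as complex vectors -/

section Flattening

variable {P : Type*} {S ι : P → Type*}

/-- A family of real vectors, read as a single complex vector. -/
noncomputable def flatten (S : P → Type*) : (∀ p, S p → ℝ) →L[ℝ] ((Σ p, S p) → ℂ) :=
  ContinuousLinearMap.pi fun a => Complex.ofRealCLM ∘L
    (ContinuousLinearMap.proj (R := ℝ) (φ := fun _ : S a.1 => ℝ) a.2) ∘L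
      (ContinuousLinearMap.proj (R := ℝ) (φ := fun p => S p → ℝ) a.1)

theorem flatten_apply (x : ∀ p, S p → ℝ) (a : Σ p, S p) : flatten S x a = (x a.1 a.2 : ℂ) := rfl

theorem flatten_injective : Function.Injective (flatten S) := by
  intro x y h
  funext p i
  exact Complex.ofReal_injective (congrFun h ⟨p, i⟩)

theorem tendsto_of_tendsto_flatten {f : ℝ → ∀ p, S p → ℝ} {l : ∀ p, S p → ℝ}
    (h : Tendsto (fun t => flatten S (f t)) atTop (𝓝 (flatten S l))) :
    Tendsto f atTop (𝓝 l) :=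
  tendsto_pi_nhds.2 fun p => tendsto_pi_nhds.2 fun i =>
    (Complex.continuous_re.tendsto _).comp (tendsto_pi_nhds.1 h ⟨p, i⟩)

variable [Fintype P]

theorem star_flatten_dotProduct [∀ p, Fintype (ι p)] (x y : ∀ p, ι p → ℝ) :
    (star (flatten ι x) ⬝ᵥ flatten ι y).re = ∑ p, x p ⬝ᵥ y p := by
  simp only [dotProduct, Fintype.sum_sigma, Complex.re_sum, Pi.star_apply, flatten_apply,
    Complex.star_def, Complex.conj_ofReal, ← Complex.ofReal_mul, Complex.ofReal_re]

variable [DecidableEq P] [∀ p, Fintype (S p)]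

theorem blockDiagonal'_mulVec_flatten (M : ∀ p, Matrix (ι p) (S p) ℝ) (x : ∀ p, S p → ℝ) :
    (toComplex (Matrix.blockDiagonal' M)).mulVec (flatten S x)
      = flatten ι (fun p => (M p).mulVec (x p)) := by
  funext ⟨p, i⟩
  simp only [Matrix.mulVec, dotProduct, Fintype.sum_sigma, toComplex, Matrix.map_apply,
    flatten_apply, Matrix.blockDiagonal'_apply]
  rw [Finset.sum_eq_single p]
  · simp
  · intro q _ hq
    simp [hq.symm]
  · simp

end Flattening

/-! ### Zero steady-state gain -/

section Equilibrium

variable {S ι : Type*} [Fintype S] [DecidableEq S] [Fintype ι]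

/-- With A invertible, an equilibrium has ξ = -A⁻¹Bx, so its output is H(0)x. -/
theorem output_eq_zero_of_equilibrium {A : Matrix S S ℝ} {B : Matrix S ι ℝ}
    {C : Matrix ι S ℝ} {D : Matrix ι ι ℝ}
    (hA : ∀ (l : ℂ) (w : S → ℂ), w ≠ 0 → (toComplex A).mulVec w = l • w → l.re < 0)
    (hH0 : transferMatrix A B C D 0 = 0) {ξ : S → ℂ} {x : ι → ℂ}
    (h : (toComplex A).mulVec ξ + (toComplex B).mulVec x = 0) :
    (toComplex C).mulVec ξ + (toComplex D).mulVec x = 0 := by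
  have hunit : IsUnit ((0 : ℂ) • (1 : Matrix S S ℂ) - toComplex A).det := by
    rw [isUnit_iff_ne_zero]
    intro h0
    obtain ⟨y, hy, hy0⟩ := Matrix.exists_mulVec_eq_zero_iff.2 h0
    rw [Matrix.sub_mulVec, Matrix.smul_mulVec, Matrix.one_mulVec, sub_eq_zero] at hy0
    simpa using hA _ y hy hy0.symm
  have h2 : ((0 : ℂ) • (1 : Matrix S S ℂ) - toComplex A).mulVec ξ = (toComplex B).mulVec x := by
    rw [Matrix.sub_mulVec, zero_smul, Matrix.zero_mulVec, zero_sub]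
    exact neg_eq_of_add_eq_zero_right h
  have h3 : ξ = (((0 : ℂ) • (1 : Matrix S S ℂ) - toComplex A)⁻¹).mulVec
      ((toComplex B).mulVec x) := by
    rw [← h2, Matrix.mulVec_mulVec, Matrix.nonsing_inv_mul _ hunit, Matrix.one_mulVec]
  have h4 := congrArg (fun G => Matrix.mulVec G x) hH0
  simpa only [transferMatrix, Matrix.add_mulVec, ← Matrix.mulVec_mulVec, ← h3,
    Matrix.zero_mulVec] using h4

end Equilibrium

/-! ### Rest points of the two dynamics -/

section Dynamics

variable {P : Type*} [Fintype P] [DecidableEq P] {𝒜 : P → Type*} [∀ p, Fintype (𝒜 p)]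
  {S : P → Type*} [∀ p, Fintype (S p)]
  {A : ∀ p, Matrix (S p) (S p) ℝ} {B : ∀ p, Matrix (S p) (𝒜 p) ℝ}
  {C : ∀ p, Matrix (𝒜 p) (S p) ℝ} {D : ∀ p, Matrix (𝒜 p) (𝒜 p) ℝ}

/-- Since 0 has nonnegative real part it is not an eigenvalue of the block-diagonal matrix, so ξ ↦
Aξ is injective, hence onto. -/
theorem exists_auxiliary_equilibrium
    (hA : ∀ (l : ℂ) (w : (Σ p, S p) → ℂ), w ≠ 0 →
      (toComplex (Matrix.blockDiagonal' A)).mulVec w = l • w → l.re < 0)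
    (x : ∀ p, 𝒜 p → ℝ) :
    ∃ ξ : ∀ p, S p → ℝ, ∀ p, (A p).mulVec (ξ p) + (B p).mulVec (x p) = 0 := by
  let f : (∀ p, S p → ℝ) →ₗ[ℝ] (∀ p, S p → ℝ) :=
    LinearMap.pi fun p => (A p).mulVecLin ∘ₗ LinearMap.proj p
  have hinj : Function.Injective f := by
    rw [← LinearMap.ker_eq_bot, LinearMap.ker_eq_bot']
    intro y hy
    by_contra hy0
    have h1 : (toComplex (Matrix.blockDiagonal' A)).mulVec (flatten S y)
        = (0 : ℂ) • flatten S y := by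
      rw [blockDiagonal'_mulVec_flatten, zero_smul]
      exact (congrArg (flatten S) hy).trans (map_zero _)
    have h2 := hA 0 (flatten S y)
      (fun h => hy0 (flatten_injective (h.trans (map_zero _).symm))) h1
    simp at h2
  obtain ⟨ξ, hξ⟩ := LinearMap.injective_iff_surjective.1 hinj fun p => -(B p).mulVec (x p)
  refine ⟨ξ, fun p => ?_⟩
  have : (A p).mulVec (ξ p) = -(B p).mulVec (x p) := congrFun hξ p
  rw [this, neg_add_cancel]

variable [∀ p, DecidableEq (S p)]

theorem output_eq_zero_of_auxiliary_equilibrium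
    (hA : ∀ (l : ℂ) (w : (Σ p, S p) → ℂ), w ≠ 0 →
      (toComplex (Matrix.blockDiagonal' A)).mulVec w = l • w → l.re < 0)
    (hH0 : transferMatrix (Matrix.blockDiagonal' A) (Matrix.blockDiagonal' B)
        (Matrix.blockDiagonal' C) (Matrix.blockDiagonal' D) 0 = 0)
    {x : ∀ p, 𝒜 p → ℝ} {ξ : ∀ p, S p → ℝ}
    (h : ∀ p, (A p).mulVec (ξ p) + (B p).mulVec (x p) = 0) (p : P) :
    (C p).mulVec (ξ p) + (D p).mulVec (x p) = 0 := by
  have h1 := output_eq_zero_of_equilibrium hA hH0 (ξ := flatten S ξ) (x := flatten 𝒜 x) (by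
    rw [blockDiagonal'_mulVec_flatten, blockDiagonal'_mulVec_flatten, ← map_add]
    exact (congrArg (flatten S) (funext h)).trans (map_zero _))
  rw [blockDiagonal'_mulVec_flatten, blockDiagonal'_mulVec_flatten, ← map_add,
    ← map_zero (flatten 𝒜)] at h1
  exact congrFun (flatten_injective h1) p

variable [∀ p, DecidableEq (𝒜 p)]

theorem isHRestPoint_iff {u : P → (∀ q, 𝒜 q) → ℝ} {γ ε : ℝ}
    (hA : ∀ (l : ℂ) (w : (Σ p, S p) → ℂ), w ≠ 0 →
      (toComplex (Matrix.blockDiagonal' A)).mulVec w = l • w → l.re < 0)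
    (hH0 : transferMatrix (Matrix.blockDiagonal' A) (Matrix.blockDiagonal' B)
        (Matrix.blockDiagonal' C) (Matrix.blockDiagonal' D) 0 = 0) (z : ∀ p, 𝒜 p → ℝ) :
    (∃ ξ : ∀ p, S p → ℝ, IsHRestPoint u γ ε A B C D z ξ) ↔ expField u γ ε z = 0 := by
  have key : ∀ ξ, hAuxField ε A B z ξ = 0 → hScoreField u γ ε C D z ξ = expField u γ ε z := by
    intro ξ h
    have h1 : adjustment ε C D z ξ = 0 := funext
      (output_eq_zero_of_auxiliary_equilibrium hA hH0 fun p => congrFun h p)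
    rw [hScoreField, h1, expField, sub_zero, neg_add_eq_sub]
  constructor
  · rintro ⟨ξ, h1, h2⟩
    rw [← key ξ h2, h1]
  · intro h
    obtain ⟨ξ, hξ⟩ := exists_auxiliary_equilibrium (B := B) hA (softmax ε z)
    have h2 : hAuxField ε A B z ξ = 0 := funext hξ
    exact ⟨ξ, (key ξ h2).trans h, h2⟩

end Dynamics

/-! ### The scalar semigroup governing the scores -/

section ScoreDecay

variable {E : Type*} [NormedAddCommGroup E] [NormedSpace ℝ E]

theorem hasDerivAt_exp_smul_one (γ t : ℝ) :
    HasDerivAt (fun t : ℝ => Real.exp (-γ * t) • (1 : E →L[ℝ] E))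
      ((Real.exp (-γ * t) • (1 : E →L[ℝ] E)) * (-γ • (1 : E →L[ℝ] E))) t := by
  have h1 : HasDerivAt (fun t : ℝ => Real.exp (-γ * t)) (Real.exp (-γ * t) * (-γ * 1)) t :=
    ((hasDerivAt_id t).const_mul (-γ)).exp
  refine (h1.smul_const (1 : E →L[ℝ] E)).congr_deriv ?_
  rw [smul_mul_smul_comm, mul_one, mul_one]

theorem norm_exp_smul_one_le (γ t : ℝ) :
    ‖Real.exp (-γ * t) • (1 : E →L[ℝ] E)‖ ≤ 1 * Real.exp (-γ * t) := by
  rw [norm_smul, Real.norm_of_nonneg (Real.exp_pos _).le, mul_comm]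
  exact mul_le_mul_of_nonneg_right ContinuousLinearMap.norm_id_le (Real.exp_pos _).le

end ScoreDecay

/-! ### Energy of the scores -/

section Lyapunov

variable {P : Type*} {𝒜 : P → Type*} [∀ p, Fintype (𝒜 p)]

theorem exists_norm_strategy_le {F : Type*} [NormedAddCommGroup F] {x : ℝ → ∀ p, 𝒜 p → ℝ}
    (hx : ∀ t, x t ∈ strategySpace 𝒜) {g : (∀ p, 𝒜 p → ℝ) → F} (hg : Continuous g) :
    ∃ M : ℝ, ∀ t, ‖g (x t)‖ ≤ M := by
  obtain ⟨M, hM⟩ := (isCompact_strategySpace (𝒜 := 𝒜)).exists_bound_of_continuousOn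
    hg.continuousOn
  exact ⟨M, fun t => hM _ (hx t)⟩

variable [Fintype P] [∀ p, Nonempty (𝒜 p)]

theorem contDiff_softmax (ε : ℝ) :
    ContDiff ℝ 1 (softmax ε : (∀ p, 𝒜 p → ℝ) → ∀ p, 𝒜 p → ℝ) := by
  refine contDiff_pi.2 fun p => contDiff_pi.2 fun i => ?_
  have h : ∀ j, ContDiff ℝ 1 fun z : ∀ p, 𝒜 p → ℝ => Real.exp (z p j / ε) := fun j =>
    ((contDiff_pi.1 (contDiff_pi.1 contDiff_id p) j).div_const ε).exp
  exact (h i).div (ContDiff.sum fun j _ => h j) fun z => (sum_exp_pos ε (z p)).ne'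

/-- The Lyapunov function of the score dynamics relative to the strategy profile `y`. -/
noncomputable def scoreEnergy (ε : ℝ) (y z : ∀ p, 𝒜 p → ℝ) : ℝ :=
  ∑ p, (softMaximum ε (z p) - z p ⬝ᵥ y p)

theorem le_scoreEnergy {ε : ℝ} (hε : 0 < ε) {y : ∀ p, 𝒜 p → ℝ} (hy : y ∈ strategySpace 𝒜)
    (z : ∀ p, 𝒜 p → ℝ) : -∑ p, ε * negEntropy (y p) ≤ scoreEnergy ε y z := by
  rw [scoreEnergy, ← Finset.sum_neg_distrib]
  refine Finset.sum_le_sum fun p _ => ?_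
  have h1 := le_softMaximum hε (z p) (hy p)
  have h2 : 0 ≤ ε / 2 * ((y p - softmaxVec ε (z p)) ⬝ᵥ (y p - softmaxVec ε (z p))) :=
    mul_nonneg (by positivity) (Finset.sum_nonneg fun _ _ => mul_self_nonneg _)
  linarith

theorem hasDerivWithinAt_scoreEnergy {ε : ℝ} (hε : 0 < ε) (y : ∀ p, 𝒜 p → ℝ)
    {z : ℝ → ∀ p, 𝒜 p → ℝ} {z' : ∀ p, 𝒜 p → ℝ} {s : Set ℝ} {t : ℝ}
    (hz : HasDerivWithinAt z z' s t) :
    HasDerivWithinAt (fun t => scoreEnergy ε y (z t))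
      (∑ p, (softmax ε (z t) p - y p) ⬝ᵥ z' p) s t := by
  refine HasDerivWithinAt.fun_sum fun p _ => ?_
  have hp := hasDerivWithinAt_pi.1 hz p
  have h1 : HasDerivWithinAt (fun t => z t p ⬝ᵥ y p) (z' p ⬝ᵥ y p) s t :=
    HasDerivWithinAt.fun_sum fun i _ => (hasDerivWithinAt_pi.1 hp i).mul_const _
  refine ((hasDerivWithinAt_softMaximum hε hp).sub h1).congr_deriv ?_
  rw [sub_dotProduct, dotProduct_comm (z' p), softmax_apply]

end Lyapunov

/-! ### Convergence of the learning dynamics -/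

section Convergence

variable {P : Type*} [Fintype P] [DecidableEq P] {𝒜 : P → Type*}
  [∀ p, Fintype (𝒜 p)] [∀ p, DecidableEq (𝒜 p)] [∀ p, Nonempty (𝒜 p)]
  {S : P → Type*} [∀ p, Fintype (S p)] [∀ p, DecidableEq (S p)]
  {A : ∀ p, Matrix (S p) (S p) ℝ} {B : ∀ p, Matrix (S p) (𝒜 p) ℝ}
  {C : ∀ p, Matrix (𝒜 p) (S p) ℝ} {D : ∀ p, Matrix (𝒜 p) (𝒜 p) ℝ}

theorem solutionsConverge (u : P → (∀ q, 𝒜 q) → ℝ) {γ ε μ : ℝ} (hγ : 0 < γ) (hμ : 0 < μ)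
    (hμε : μ < ε)
    (hA : ∀ (l : ℂ) (w : (Σ p, S p) → ℂ), w ≠ 0 →
      (toComplex (Matrix.blockDiagonal' A)).mulVec w = l • w → l.re < 0)
    (hH : IsStablePositiveReal (transferMatrix (Matrix.blockDiagonal' A)
        (Matrix.blockDiagonal' B) (Matrix.blockDiagonal' C) (Matrix.blockDiagonal' D)))
    (hH0 : transferMatrix (Matrix.blockDiagonal' A) (Matrix.blockDiagonal' B)
        (Matrix.blockDiagonal' C) (Matrix.blockDiagonal' D) 0 = 0)
    (hm : NegPayoffHypoMonotone u μ) : SolutionsConverge u γ ε A B C D := by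
  intro z ξ hsol
  have hε := hμ.trans hμε
  obtain ⟨zbar, hzbar⟩ := exists_fixedPoint u hμ hμε hm
  set xbar := softmax ε zbar with hxbar
  have hxbarmem : xbar ∈ strategySpace 𝒜 := softmax_mem ε zbar
  obtain ⟨ξbar, hξbar⟩ := exists_auxiliary_equilibrium (B := B) hA xbar
  have hadj := output_eq_zero_of_auxiliary_equilibrium hA hH0 hξbar
  set x : ℝ → ∀ p, 𝒜 p → ℝ := fun t => softmax ε (z t) with hx
  have hxmem : ∀ t, x t ∈ strategySpace 𝒜 := fun t => softmax_mem ε (z t)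
  set w : ℝ → ∀ p, 𝒜 p → ℝ := fun t => x t - xbar with hw
  set e : ℝ → ∀ p, S p → ℝ := fun t => ξ t - ξbar with he
  set v : ℝ → ∀ p, 𝒜 p → ℝ := fun t => adjustment ε C D (z t) (ξ t) with hv
  have hzc : ContinuousOn z (Ici 0) := fun t ht => (hsol t ht).1.continuousWithinAt
  have hξc : ContinuousOn ξ (Ici 0) := fun t ht => (hsol t ht).2.continuousWithinAt
  have hUc := (contDiff_payoffMap u).continuous
  have hxc : ContinuousOn x (Ici 0) := (continuous_softmax ε).comp_continuousOn hzc
  have hwc : ContinuousOn w (Ici 0) := hxc.sub continuousOn_const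
  -- The equilibrium output is zero, so the deviations e and w drive the same linear system with the
  -- full adjustment v as output.
  have hout : ∀ t, (toComplex (Matrix.blockDiagonal' C)).mulVec (flatten S (e t))
      + (toComplex (Matrix.blockDiagonal' D)).mulVec (flatten 𝒜 (w t)) = flatten 𝒜 (v t) := by
    intro t
    rw [blockDiagonal'_mulVec_flatten, blockDiagonal'_mulVec_flatten, ← map_add]
    congr 1
    funext p
    have h1 := hadj p
    simp only [he, hw, hv, adjustment, hx, Pi.add_apply, Pi.sub_apply, Matrix.mulVec_sub]
    rw [sub_add_sub_comm, h1, sub_zero]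
  have hstate : ∀ t, 0 ≤ t → HasDerivWithinAt (fun t => flatten S (e t))
      ((toComplex (Matrix.blockDiagonal' A)).mulVec (flatten S (e t))
        + (toComplex (Matrix.blockDiagonal' B)).mulVec (flatten 𝒜 (w t))) (Ici 0) t := by
    intro t ht
    have h1 := (flatten S).hasFDerivAt.comp_hasDerivWithinAt t ((hsol t ht).2.sub_const ξbar)
    refine h1.congr_deriv ?_
    rw [blockDiagonal'_mulVec_flatten, blockDiagonal'_mulVec_flatten, ← map_add]
    congr 1
    funext p
    have h1 := hξbar p
    simp only [he, hw, hAuxField, hx, Pi.add_apply, Pi.sub_apply, Matrix.mulVec_sub]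
    rw [sub_add_sub_comm, h1, sub_zero]
  obtain ⟨W, hW⟩ := exists_norm_strategy_le hxmem (g := fun y => flatten 𝒜 (y - xbar))
    ((flatten 𝒜).continuous.comp (continuous_id.sub continuous_const))
  set f : ℝ → (Σ p, S p) → ℂ :=
    fun t => (toComplex (Matrix.blockDiagonal' B)).mulVec (flatten 𝒜 (w t)) with hf
  have hgc : Continuous fun y => (toComplex (Matrix.blockDiagonal' B)).mulVec
      (flatten 𝒜 (y - xbar)) :=
    (Continuous.matrix_mulVec continuous_const continuous_id).comp
      ((flatten 𝒜).continuous.comp (continuous_id.sub continuous_const))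
  obtain ⟨Φ, K, a, hK, ha, hΦ0, hΦ, -, hΦn⟩ := exists_decaying_semigroup
    (mulVecOperator (toComplex (Matrix.blockDiagonal' A))) hA
  obtain ⟨Mf, hMf⟩ := exists_norm_strategy_le hxmem hgc
  obtain ⟨R, hR⟩ := exists_norm_le_of_forced_linear ha hK.le hΦ0 hΦ hΦn (f := f) hstate
    (fun t _ => hMf t)
  obtain ⟨c, hc⟩ := exists_le_integral_supply hA hH
    ((flatten 𝒜).continuous.comp_continuousOn hwc) (fun t _ => hW t) hR hstate
  have hsupply : ∀ T, 0 ≤ T → -c ≤ ∫ t in (0 : ℝ)..T, ∑ p, w t p ⬝ᵥ v t p := by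
    intro T hT
    refine (hc T hT).trans (le_of_eq ?_)
    refine intervalIntegral.integral_congr fun t _ => ?_
    rw [← star_flatten_dotProduct, ← hout]
    rfl
  have hξv : ContinuousOn v (Ici 0) := by
    refine continuousOn_pi.2 fun p => ?_
    exact ((Continuous.matrix_mulVec continuous_const continuous_id).comp_continuousOn
      (continuousOn_pi.1 hξc p)).add
      ((Continuous.matrix_mulVec continuous_const continuous_id).comp_continuousOn
        (continuousOn_pi.1 hxc p))
  have hdot : ∀ {f g : ℝ → ∀ p, 𝒜 p → ℝ}, ContinuousOn f (Ici 0) → ContinuousOn g (Ici 0) →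
      ContinuousOn (fun t => ∑ p, f t p ⬝ᵥ g t p) (Ici 0) := by
    intro f g hf hg
    simp only [dotProduct]
    exact continuousOn_finsetSum _ fun p _ => continuousOn_finsetSum _ fun i _ =>
      (continuousOn_pi.1 (continuousOn_pi.1 hf p) i).mul
        (continuousOn_pi.1 (continuousOn_pi.1 hg p) i)
  have hii : ∀ {f : ℝ → ℝ}, ContinuousOn f (Ici 0) → ∀ T, 0 ≤ T →
      IntervalIntegrable f MeasureTheory.volume 0 T := by
    intro f hf T hT
    refine (hf.mono ?_).intervalIntegrable
    rw [uIcc_of_le hT]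
    exact Icc_subset_Ici_self
  set q : ℝ → ℝ := fun t => ∑ p, w t p ⬝ᵥ w t p with hq
  set z' : ℝ → ∀ p, 𝒜 p → ℝ := fun t => hScoreField u γ ε C D (z t) (ξ t) with hz'
  have hz'c : ContinuousOn z' (Ici 0) :=
    ((hzc.neg.add (hUc.comp_continuousOn hxc)).sub hξv).const_smul γ
  have hz'eq : ∀ t, z' t = γ • (-(z t - zbar) + (payoffMap u (x t) - payoffMap u xbar) - v t) := by
    intro t
    rw [hzbar]
    change γ • (-z t + payoffMap u (x t) - v t) = _
    congr 1
    abel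
  -- Cocoercivity of the soft-max map yields -ε|w|², hypo-monotonicity of the payoffs costs at most
  -- μ|w|².
  have hpow : ∀ t, ∑ p, w t p ⬝ᵥ z' t p
      ≤ -(γ * (ε - μ)) * q t - γ * ∑ p, w t p ⬝ᵥ v t p := by
    intro t
    have h1 : ∑ p, w t p ⬝ᵥ z' t p = γ * (-(∑ p, w t p ⬝ᵥ (z t p - zbar p))
        + (∑ p, w t p ⬝ᵥ (payoffMap u (x t) p - payoffMap u xbar p))
        - ∑ p, w t p ⬝ᵥ v t p) := by
      rw [← Finset.sum_neg_distrib, ← Finset.sum_add_distrib, ← Finset.sum_sub_distrib,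
        Finset.mul_sum]
      refine Finset.sum_congr rfl fun p _ => ?_
      rw [hz'eq, Pi.smul_apply, dotProduct_smul, smul_eq_mul, Pi.sub_apply, dotProduct_sub,
        Pi.add_apply, dotProduct_add, Pi.neg_apply, dotProduct_neg]
      rfl
    have h2 : ε * q t ≤ ∑ p, w t p ⬝ᵥ (z t p - zbar p) := by
      rw [hq, Finset.mul_sum]
      refine Finset.sum_le_sum fun p _ => ?_
      rw [dotProduct_comm (w t p) (z t p - zbar p)]
      exact softmaxVec_cocoercive hε (z t p) (zbar p)
    have h3 : ∑ p, w t p ⬝ᵥ (payoffMap u (x t) p - payoffMap u xbar p) ≤ μ * q t := by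
      have := hm _ (hxmem t) _ hxbarmem
      change ∑ p, (x t p - xbar p) ⬝ᵥ (payoffMap u (x t) p - payoffMap u xbar p)
        ≤ μ * ∑ p, (x t p - xbar p) ⬝ᵥ (x t p - xbar p)
      linarith
    rw [h1]
    nlinarith [mul_le_mul_of_nonneg_left h2 hγ.le, mul_le_mul_of_nonneg_left h3 hγ.le]
  have hVd : ∀ t, 0 ≤ t → HasDerivWithinAt (fun t => scoreEnergy ε xbar (z t))
      (∑ p, w t p ⬝ᵥ z' t p) (Ici 0) t :=
    fun t ht => hasDerivWithinAt_scoreEnergy hε xbar (hsol t ht).1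
  -- Integrated energy balance: the energy is bounded below by minus ε times the negative entropy of
  -- xbar, and the supply to the adjustment block by -c.
  obtain ⟨Q, hQ⟩ : ∃ Q : ℝ, ∀ T, 0 ≤ T → ∫ t in (0 : ℝ)..T, q t ≤ Q := by
    refine ⟨(scoreEnergy ε xbar (z 0) + (∑ p, ε * negEntropy (xbar p)) + γ * c)
      / (γ * (ε - μ)), fun T hT => ?_⟩
    have hpos : 0 < γ * (ε - μ) := mul_pos hγ (sub_pos.2 hμε)
    rw [le_div_iff₀ hpos]
    have h1 : ∫ t in (0 : ℝ)..T, ∑ p, w t p ⬝ᵥ z' t p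
        = scoreEnergy ε xbar (z T) - scoreEnergy ε xbar (z 0) :=
      intervalIntegral.integral_eq_sub_of_hasDerivAt_of_le hT
        (fun t ht => (hVd t ht.1).continuousWithinAt.mono Icc_subset_Ici_self)
        (fun t ht => (hVd t ht.1.le).hasDerivAt (Ici_mem_nhds ht.1)) (hii (hdot hwc hz'c) T hT)
    have h2 : ∫ t in (0 : ℝ)..T, ∑ p, w t p ⬝ᵥ z' t p
        ≤ ∫ t in (0 : ℝ)..T, (-(γ * (ε - μ)) * q t - γ * ∑ p, w t p ⬝ᵥ v t p) :=
      intervalIntegral.integral_mono_on hT (hii (hdot hwc hz'c) T hT)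
        (hii ((continuousOn_const.mul (hdot hwc hwc)).sub
          (continuousOn_const.mul (hdot hwc hξv))) T hT) fun t _ => hpow t
    rw [intervalIntegral.integral_sub ((hii (hdot hwc hwc) T hT).const_mul _)
      ((hii (hdot hwc hξv) T hT).const_mul _), intervalIntegral.integral_const_mul,
      intervalIntegral.integral_const_mul, h1] at h2
    have h3 := le_scoreEnergy hε hxbarmem (z T)
    have h4 := mul_le_mul_of_nonneg_left (hsupply T hT) hγ.le
    linarith
  have hvof : ∀ t, ∀ p i, v t p i = ((toComplex (Matrix.blockDiagonal' C)).mulVec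
      (flatten S (e t)) ⟨p, i⟩ + (toComplex (Matrix.blockDiagonal' D)).mulVec
        (flatten 𝒜 (w t)) ⟨p, i⟩).re := by
    intro t p i
    have := congrFun (hout t) ⟨p, i⟩
    rw [Pi.add_apply] at this
    rw [this, flatten_apply, Complex.ofReal_re]
  obtain ⟨Mv, hMv⟩ : ∃ Mv : ℝ, ∀ t, 0 ≤ t → ‖v t‖ ≤ Mv := by
    have hcont : Continuous fun y : ((Σ p, S p) → ℂ) × ((Σ p, 𝒜 p) → ℂ) =>
        fun p i => ((toComplex (Matrix.blockDiagonal' C)).mulVec y.1 ⟨p, i⟩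
          + (toComplex (Matrix.blockDiagonal' D)).mulVec y.2 ⟨p, i⟩).re := by
      simp only [Matrix.mulVec, dotProduct]
      fun_prop
    obtain ⟨M, hM⟩ := ((isCompact_closedBall (0 : (Σ p, S p) → ℂ) R).prod
      (isCompact_closedBall (0 : (Σ p, 𝒜 p) → ℂ) W)).exists_bound_of_continuousOn
        hcont.continuousOn
    refine ⟨M, fun t ht => ?_⟩
    have := hM (flatten S (e t), flatten 𝒜 (w t))
      ⟨mem_closedBall_zero_iff.2 (hR t ht), mem_closedBall_zero_iff.2 (hW t)⟩
    have hvt : v t = _ := funext fun p => funext fun i => hvof t p i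
    rw [hvt]
    exact this
  obtain ⟨MU, hMU⟩ := exists_norm_strategy_le hxmem (g := fun y => payoffMap u y - payoffMap u xbar)
    (hUc.sub continuous_const)
  set g : ℝ → ∀ p, 𝒜 p → ℝ := fun t => γ • (payoffMap u (x t) - payoffMap u xbar - v t) with hg
  -- The score error obeys a stable scalar equation whose input g is bounded, and vanishes
  -- asymptotically once x → xbar and v → 0.
  have hscore : ∀ t, 0 ≤ t → HasDerivWithinAt (fun t => z t - zbar)
      ((-γ • (1 : (∀ p, 𝒜 p → ℝ) →L[ℝ] (∀ p, 𝒜 p → ℝ))) (z t - zbar) + g t) (Ici 0) t := by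
    intro t ht
    refine ((hsol t ht).1.sub_const zbar).congr_deriv ?_
    refine (hz'eq t).trans ?_
    simp only [hg, _root_.smul_apply, one_apply_eq_self]
    module
  have hΨ0 : Real.exp (-γ * 0) • (1 : (∀ p, 𝒜 p → ℝ) →L[ℝ] (∀ p, 𝒜 p → ℝ)) = 1 := by simp
  have hgM : ∀ t, 0 ≤ t → ‖g t‖ ≤ γ * (MU + Mv) := by
    intro t ht
    rw [hg, norm_smul, Real.norm_of_nonneg hγ.le]
    exact mul_le_mul_of_nonneg_left ((norm_sub_le _ _).trans (add_le_add (hMU t) (hMv t ht))) hγ.le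
  obtain ⟨Rz, hRz⟩ := exists_norm_le_of_forced_linear hγ zero_le_one hΨ0
    (hasDerivAt_exp_smul_one γ) (fun t _ => norm_exp_smul_one_le γ t) hscore hgM
  have hz'n : ∀ t, 0 ≤ t → ‖z' t‖ ≤ γ * Rz + γ * (MU + Mv) := by
    intro t ht
    have : z' t = -(γ • (z t - zbar)) + g t := by
      rw [hz'eq, hg]
      module
    rw [this]
    refine (norm_add_le _ _).trans (add_le_add ?_ (hgM t ht))
    rw [norm_neg, norm_smul, Real.norm_of_nonneg hγ.le]
    exact mul_le_mul_of_nonneg_left (hRz t ht) hγ.le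
  have hzlip : ∀ s t, 0 ≤ s → s ≤ t → ‖z t - z s‖ ≤ (γ * Rz + γ * (MU + Mv)) * (t - s) := by
    intro s t hs hst
    have := (convex_Ici (0 : ℝ)).norm_image_sub_le_of_norm_hasDerivWithin_le
      (fun r hr => (hsol r hr).1) (fun r hr => hz'n r hr) (show s ∈ Ici (0 : ℝ) from hs)
      (show t ∈ Ici (0 : ℝ) from hs.trans hst)
    rwa [Real.norm_of_nonneg (sub_nonneg.2 hst)] at this
  -- The scores stay in a ball and move with bounded speed, and |σ(y) - xbar|² is Lipschitz on that
  -- ball, so q is Lipschitz in time.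
  have hq0 : Tendsto q atTop (𝓝 0) := by
    have hcd : ContDiff ℝ 1 fun y : ∀ p, 𝒜 p → ℝ =>
        ∑ p, (softmax ε y p - xbar p) ⬝ᵥ (softmax ε y p - xbar p) := by
      simp only [dotProduct, Pi.sub_apply]
      have h1 : ∀ p i, ContDiff ℝ 1 fun y : ∀ p, 𝒜 p → ℝ => softmax ε y p i - xbar p i :=
        fun p i => (contDiff_pi.1 (contDiff_pi.1 (contDiff_softmax ε) p) i).sub contDiff_const
      exact ContDiff.sum fun p _ => ContDiff.sum fun i _ => (h1 p i).mul (h1 p i)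
    obtain ⟨Lq, hLq⟩ := hcd.contDiffOn.exists_lipschitzOnWith one_ne_zero
      (convex_closedBall zbar Rz) (isCompact_closedBall zbar Rz)
    have hball : ∀ t, 0 ≤ t → z t ∈ Metric.closedBall zbar Rz := fun t ht =>
      mem_closedBall_iff_norm.2 (hRz t ht)
    have hM0 : 0 ≤ γ * Rz + γ * (MU + Mv) := (norm_nonneg _).trans (hz'n 0 le_rfl)
    refine tendsto_zero_of_lipschitz_of_integral_le (K := Lq * (γ * Rz + γ * (MU + Mv)))
      (mul_nonneg Lq.2 hM0) (fun t _ => Finset.sum_nonneg fun p _ => Finset.sum_nonneg fun i _ =>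
        mul_self_nonneg _) ?_ hQ
    intro s t hs hst
    have h1 := hLq.dist_le_mul _ (hball t (hs.trans hst)) _ (hball s hs)
    rw [Real.dist_eq, dist_eq_norm] at h1
    refine h1.trans ?_
    rw [mul_assoc]
    exact mul_le_mul_of_nonneg_left (hzlip s t hs hst) Lq.2
  have hw0 : Tendsto w atTop (𝓝 0) := by
    refine tendsto_pi_nhds.2 fun p => tendsto_pi_nhds.2 fun i => ?_
    have h1 : Tendsto (fun t => Real.sqrt (q t)) atTop (𝓝 0) := by
      simpa only [Function.comp_def, Real.sqrt_zero] using
        (Real.continuous_sqrt.tendsto 0).comp hq0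
    refine squeeze_zero_norm (fun t => Real.abs_le_sqrt ?_) h1
    rw [sq]
    exact (Finset.single_le_sum (f := fun i => w t p i * w t p i)
      (fun i _ => mul_self_nonneg _) (Finset.mem_univ i)).trans
      (Finset.single_le_sum (f := fun p => w t p ⬝ᵥ w t p)
        (fun p _ => Finset.sum_nonneg fun i _ => mul_self_nonneg _) (Finset.mem_univ p))
  have hxlim : Tendsto x atTop (𝓝 xbar) := by
    simpa [hw] using hw0.add_const xbar
  have hwf0 : Tendsto (fun t => flatten 𝒜 (w t)) atTop (𝓝 0) := by
    have := ((flatten 𝒜).continuous.tendsto 0).comp hw0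
    rwa [map_zero] at this
  have hf0 : Tendsto f atTop (𝓝 0) := by
    have := ((show Continuous fun y : (Σ p, 𝒜 p) → ℂ =>
      (toComplex (Matrix.blockDiagonal' B)).mulVec y from
        Continuous.matrix_mulVec continuous_const continuous_id).tendsto 0).comp hwf0
    rw [Matrix.mulVec_zero] at this
    exact this
  have he0 := tendsto_zero_of_forced_linear ha hK.le hΦ0 hΦ hΦn (f := f) hstate hf0
  have hv0 : Tendsto v atTop (𝓝 0) := by
    refine tendsto_of_tendsto_flatten ?_
    rw [map_zero]
    have h1 := ((show Continuous fun y : (Σ p, S p) → ℂ =>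
      (toComplex (Matrix.blockDiagonal' C)).mulVec y from
        Continuous.matrix_mulVec continuous_const continuous_id).tendsto 0).comp he0
    have h2 := ((show Continuous fun y : (Σ p, 𝒜 p) → ℂ =>
      (toComplex (Matrix.blockDiagonal' D)).mulVec y from
        Continuous.matrix_mulVec continuous_const continuous_id).tendsto 0).comp hwf0
    have h3 := h1.add h2
    simp only [Matrix.mulVec_zero, add_zero] at h3
    exact h3.congr hout
  have hg0 : Tendsto g atTop (𝓝 0) := by
    have h1 := ((((hUc.tendsto xbar).comp hxlim).sub_const (payoffMap u xbar)).sub hv0).const_smul γ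
    simpa using h1
  have hzlim := tendsto_zero_of_forced_linear hγ zero_le_one hΨ0
    (hasDerivAt_exp_smul_one γ) (fun t _ => norm_exp_smul_one_le γ t) hscore hg0
  refine ⟨zbar, hzbar, ?_, hxlim, isNashDistribution_of_fixedPoint u hε hzbar⟩
  simpa using hzlim.add_const zbar

end Convergence

end HExpDRL

/-! ### The main theorem -/

theorem theorem2 {P : Type*} [Fintype P] [DecidableEq P] {𝒜 : P → Type*}
    [∀ p, Fintype (𝒜 p)] [∀ p, DecidableEq (𝒜 p)] [∀ p, Nonempty (𝒜 p)]
    {S : P → Type*} [∀ p, Fintype (S p)] [∀ p, DecidableEq (S p)]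
    (u : P → (∀ q, 𝒜 q) → ℝ) (γ ε : ℝ) (hγ : 0 < γ) (hε : 0 < ε)
    (A : ∀ p, Matrix (S p) (S p) ℝ) (B : ∀ p, Matrix (S p) (𝒜 p) ℝ)
    (C : ∀ p, Matrix (𝒜 p) (S p) ℝ) (D : ∀ p, Matrix (𝒜 p) (𝒜 p) ℝ)
    (hfin : {z : ∀ p, 𝒜 p → ℝ | HExpDRL.payoffMap u (HExpDRL.softmax ε z) = z}.Finite)
    (hstab : HExpDRL.IsStabilizable (Matrix.blockDiagonal' A) (Matrix.blockDiagonal' B))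
    (hdet : HExpDRL.IsDetectable (Matrix.blockDiagonal' A) (Matrix.blockDiagonal' C))
    (hH : HExpDRL.IsStablePositiveReal
      (HExpDRL.transferMatrix (Matrix.blockDiagonal' A) (Matrix.blockDiagonal' B)
        (Matrix.blockDiagonal' C) (Matrix.blockDiagonal' D)))
    (hH0 : HExpDRL.transferMatrix (Matrix.blockDiagonal' A) (Matrix.blockDiagonal' B)
        (Matrix.blockDiagonal' C) (Matrix.blockDiagonal' D) 0 = 0) :
    (∀ z : ∀ p, 𝒜 p → ℝ,
      (∃ ξ : ∀ p, S p → ℝ, HExpDRL.IsHRestPoint u γ ε A B C D z ξ) ↔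
        HExpDRL.expField u γ ε z = 0) ∧
    (HExpDRL.NegPayoffMonotone u → HExpDRL.SolutionsConverge u γ ε A B C D) ∧
    (∀ μ : ℝ, 0 < μ → HExpDRL.NegPayoffHypoMonotone u μ → μ < ε →
      HExpDRL.SolutionsConverge u γ ε A B C D) := by
  have hA : ∀ (l : ℂ) (w : (Σ p, S p) → ℂ), w ≠ 0 →
      (HExpDRL.toComplex (Matrix.blockDiagonal' A)).mulVec w = l • w → l.re < 0 :=
    fun _ _ hw hl => HExpDRL.re_neg_of_eigenvector hstab hdet hH hw hl
  refine ⟨fun z => HExpDRL.isHRestPoint_iff hA hH0 z, fun hm => ?_,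
    fun μ hμ hm hμε => HExpDRL.solutionsConverge u hγ hμ hμε hA hH hH0 hm⟩
  -- Monotonicity implies hypo-monotonicity with any positive constant; ε / 2 lies below ε.
  refine HExpDRL.solutionsConverge u hγ (half_pos hε) (half_lt_self hε) hA hH hH0
    fun x hx x' hx' => le_trans ?_ (hm x hx x' hx')
  have h : 0 ≤ ∑ p, (x p - x' p) ⬝ᵥ (x p - x' p) :=
    Finset.sum_nonneg fun _ _ => Finset.sum_nonneg fun _ _ => mul_self_nonneg _
  nlinarith
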